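/- **Setting.** All functions are real and smooth. Write $p=u'$, $q=u''$, and let $u'''=f(x,u,p,q)$ be given on an open set $\Omega\subseteq\mathbb R^4$; let $\pi(x,u,p,q)=(x,u,p)$ and $\hat D_x=\partial_x+p\,\partial_u+q\,\partial_p+f\,\partial_q$. Define $$I_1=-f_q,\quad I_2=-\tfrac29I_1^2-f_p-\tfrac13\hat D_xI_1,\quad I_3=J_3^3=-\tfrac13I_1I_2-f_u-\tfrac12\hat D_xI_2,\quad I_4=(J_3)_q,$$ $$I_5=\frac{I_1J_3+3\hat D_xJ_3}{3J_3^2},\quad I_7=-J_3^2\,(I_5)_q,\quad I_9=2J_3\hat D_xI_5-I_2+J_3^2I_5^2,\quad K=\frac{I_9}{J_3^2},$$ $$Q=-\frac{I_1I_7+3J_3^2(I_5)_p+3(J_3)_u-3J_3I_4\hat D_xI_5}{3J_3}.$$ A contact transformation $\bar x=\varphi(x,u,p)$, $\bar u=\psi(x,u,p)$, $\bar p=\chi(x,u,p)$ with contact factor $\lambda(x,u,p)$ has non-zero Jacobian and satisfies $d\psi-\chi\,d\varphi=\lambda\,(du-p\,dx)$. It is said to take $u'''=f$ to $\bar u'''=\bar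 a^3(\bar x)\bar u$ on an open set $V\subseteq\Omega$ if it is defined on $\pi(V)$, $\hat D_x\varphi\ne0$ on $V$, and, with $\eta=\hat D_x\chi/\hat D_x\varphi$, one has $\hat D_x\eta/\hat D_x\varphi=\bar a(\varphi)^3\psi$ on $V$. Here $\bar a$ is smooth and nowhere zero on an open subset of $\mathbb R$ containing the values of $\varphi$. For functions $H,\ b\neq0,\ a_1\ne 0,\ \varphi,\ \chi,\ \psi$ of $(x,u,p)$ and $\eta$ of $(x,u,p,q)$ consider, with $\bar f=b^3\psi$, the systems 1. $-\frac{2}{J_3}\hat D_xH+H^2=K$; 2. $\hat D_xb=-J_3H\,b$; 3. $\hat D_xa_1=J_3(H+I_5)a_1,\quad (a_1)_u=(HI_7-Q)a_1,\quad (a_1)_p=\big(I_4(H+I_5)-\frac{I_7}{J_3}\big)a_1,\quad (a_1)_q=0$; 4. $\hat D_x\varphi=-\frac{J_3}{b},\quad \varphi_u=-\frac{I_7}{b},\quad \varphi_p=-\frac{I_4}{b}$; 5. $\hat D_x\eta=-\frac{J_3}{b}\bar f,\quad \eta_u=\Big(\frac{(H+I_5)^2}{2}+\frac{I_2}{2J_3^2}\Big)b^2a_1-\frac{I_7}{b}\bar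 f,\quad \eta_p=\Big(\frac{H+I_5}{J_3}+\frac{I_1}{3J_3^2}\Big)b^2a_1-\frac{I_4}{b}\bar f,\quad \eta_q=\frac{b^2a_1}{J_3^2},$ $\hat D_x\chi=-\frac{J_3}{b}\eta,\quad \chi_u=-(H+I_5)ba_1-\frac{I_7}{b}\eta,\quad \chi_p=-\frac{ba_1}{J_3}-\frac{I_4}{b}\eta,$ $I_7\hat D_x\psi=J_3(\psi_u-a_1),\quad \psi_x=\chi\varphi_x-pa_1,\quad \psi_p=-\frac{I_4}{b}\chi,$ together with $\chi=\hat D_x\psi/\hat D_x\varphi$ and $\eta=\hat D_x\chi/\hat D_x\varphi$. **Proposition.** Suppose that the contact transformation $(\varphi,\psi,\chi)$, with contact factor $a_1$, takes $u'''=f$ to $\bar u'''=\bar a^3(\bar x)\bar u$ on $\Omega$. Then: (i) $I_3\neq0$ on $\Omega$, and the functions $H=\bar a'(\varphi)/\bar a(\varphi)^2$, $b=\bar a(\varphi)$, $a_1$, $\varphi$, $\eta=\hat D_x\chi/\hat D_x\varphi$, $\chi$, $\psi$ solve the systems 1–5 on $\Omega$, with $b$ and $a_1$ nowhere zero and, if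 $\Omega\ne\emptyset$, with none of $\varphi,\eta,\chi,\psi$ identically zero. (ii) Conversely, let $V\subseteq\Omega$ be open and let $H,b,a_1,\varphi,\eta,\chi,\psi$ be any smooth solution of the systems 1–5 on $V$ (the functions of $(x,u,p)$ being defined on $\pi(V)$), with $b$ and $a_1$ nowhere zero. For every smooth nowhere zero $\bar a$, defined on an open set containing the values of $\varphi$, with $b=\bar a(\varphi)$ on $\pi(V)$, the triple $(\varphi,\psi,\chi)$ is a contact transformation with contact factor $a_1$ which takes $u'''=f$ to $\bar u'''=\bar a^3(\bar x)\bar u$ on $V$. Moreover, every point of $V$ has an open neighbourhood in $V$ on which such an $\bar a$ exists, and there $H=\bar a'(\varphi)/\bar a(\varphi)^2$. -/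

import Mathlib

open scoped ContDiff

namespace ThirdOrderODE

/-- Points `(x, u, p)`, where `p = u'`. -/
abbrev Jet1 := ℝ × ℝ × ℝ

/-- Points `(x, u, p, q)`, where `p = u'` and `q = u''`. -/
abbrev Jet2 := ℝ × ℝ × ℝ × ℝ

/-- The projection `(x, u, p, q) ↦ (x, u, p)`. -/
def proj (z : Jet2) : Jet1 := (z.1, z.2.1, z.2.2.1)

/-- A function of `(x, u, p)` regarded as a function of `(x, u, p, q)`. -/
def lift (F : Jet1 → ℝ) : Jet2 → ℝ := fun z => F (proj z)

noncomputable section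

/-- `F_x` for a function `F` of `(x, u, p, q)`. -/
def pdx (F : Jet2 → ℝ) (z : Jet2) : ℝ := fderiv ℝ F z (1, 0, 0, 0)

/-- `F_u` for a function `F` of `(x, u, p, q)`. -/
def pdu (F : Jet2 → ℝ) (z : Jet2) : ℝ := fderiv ℝ F z (0, 1, 0, 0)

/-- `F_p` for a function `F` of `(x, u, p, q)`. -/
def pdp (F : Jet2 → ℝ) (z : Jet2) : ℝ := fderiv ℝ F z (0, 0, 1, 0)

/-- `F_q` for a function `F` of `(x, u, p, q)`. -/
def pdq (F : Jet2 → ℝ) (z : Jet2) : ℝ := fderiv ℝ F z (0, 0, 0, 1)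

/-- The total derivative along `u''' = f`:
`D̂ₓ = ∂/∂x + p ∂/∂u + q ∂/∂p + f ∂/∂q`.
On functions of `(x, u, p)` it does not involve `f`. -/
def Dhat (f F : Jet2 → ℝ) (z : Jet2) : ℝ :=
  pdx F z + z.2.2.1 * pdu F z + z.2.2.2 * pdp F z + f z * pdq F z

/-- The real cube root, an odd function. -/
def cbrt (r : ℝ) : ℝ := Real.sign r * |r| ^ ((1 : ℝ) / 3)

theorem cbrt_pow_three (r : ℝ) : cbrt r ^ 3 = r := by
  have h : (|r| ^ ((1 : ℝ) / 3)) ^ 3 = |r| := by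
    rw [← Real.rpow_natCast, ← Real.rpow_mul (abs_nonneg r)]
    norm_num
  unfold cbrt
  rw [mul_pow, h]
  rcases lt_trichotomy r 0 with hr | hr | hr
  · rw [Real.sign_of_neg hr, abs_of_neg hr]; ring
  · simp [hr]
  · rw [Real.sign_of_pos hr, abs_of_pos hr]; ring

def I1 (f : Jet2 → ℝ) : Jet2 → ℝ := fun z => -pdq f z

def I2 (f : Jet2 → ℝ) : Jet2 → ℝ := fun z =>
  -(2 / 9) * I1 f z ^ 2 - pdp f z - (1 / 3) * Dhat f (I1 f) z

def I3 (f : Jet2 → ℝ) : Jet2 → ℝ := fun z =>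
  -(1 / 3) * I1 f z * I2 f z - pdu f z - (1 / 2) * Dhat f (I2 f) z

/-- `J₃` is the real function with `J₃ ^ 3 = I₃`. -/
def J3 (f : Jet2 → ℝ) : Jet2 → ℝ := fun z => cbrt (I3 f z)

def I4 (f : Jet2 → ℝ) : Jet2 → ℝ := fun z => pdq (J3 f) z

def I5 (f : Jet2 → ℝ) : Jet2 → ℝ := fun z =>
  (1 / (3 * J3 f z ^ 2)) * (I1 f z * J3 f z + 3 * Dhat f (J3 f) z)

def I7 (f : Jet2 → ℝ) : Jet2 → ℝ := fun z => -pdq (I5 f) z * J3 f z ^ 2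

def I9 (f : Jet2 → ℝ) : Jet2 → ℝ := fun z =>
  2 * J3 f z * Dhat f (I5 f) z - I2 f z + J3 f z ^ 2 * I5 f z ^ 2

def K (f : Jet2 → ℝ) : Jet2 → ℝ := fun z => I9 f z / J3 f z ^ 2

def Q (f : Jet2 → ℝ) : Jet2 → ℝ := fun z =>
  -((I1 f z * I7 f z + 3 * J3 f z ^ 2 * pdp (I5 f) z + 3 * pdu (J3 f) z
      - 3 * J3 f z * I4 f z * Dhat f (I5 f) z) / (3 * J3 f z))

/-- `x̄ = φ(x,u,p)`, `ū = ψ(x,u,p)`, `p̄ = χ(x,u,p)` is a smooth contact transformation on the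
set `U` with non-zero Jacobian and contact factor `lam`:
`dψ - χ dφ = lam (du - p dx)`. -/
structure IsContactTransformation (U : Set Jet1) (φ ψ χ lam : Jet1 → ℝ) : Prop where
  smooth_φ : ContDiffOn ℝ ∞ φ U
  smooth_ψ : ContDiffOn ℝ ∞ ψ U
  smooth_χ : ContDiffOn ℝ ∞ χ U
  contact : ∀ y ∈ U, ∀ v : Jet1,
    fderiv ℝ ψ y v - χ y * fderiv ℝ φ y v = lam y * (v.2.1 - y.2.2 * v.1)
  jacobian : ∀ y ∈ U, (fderiv ℝ (fun w : Jet1 => (φ w, ψ w, χ w)) y).det ≠ 0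

/-- The second derivative `q̄ = D̂ₓχ / D̂ₓφ` of the prolonged transformation. -/
def prolong (f : Jet2 → ℝ) (φ χ : Jet1 → ℝ) : Jet2 → ℝ := fun z =>
  Dhat f (lift χ) z / Dhat f (lift φ) z

/-- On `Ω` the prolongation of `(φ, ψ, χ)` is defined and takes `u''' = f` to `ū''' = fbar`:
the third derivative `D̂ₓq̄ / D̂ₓφ`, computed along `u''' = f`, is `fbar(x̄, ū, p̄, q̄)`. -/
structure TransformsODE (f : Jet2 → ℝ) (Ω : Set Jet2) (fbar : Jet2 → ℝ)
    (φ ψ χ : Jet1 → ℝ) : Prop where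
  regular : ∀ z ∈ Ω, Dhat f (lift φ) z ≠ 0
  equation : ∀ z ∈ Ω, Dhat f (prolong f φ χ) z / Dhat f (lift φ) z =
    fbar (φ (proj z), ψ (proj z), χ (proj z), prolong f φ χ z)

/-- The right-hand side of `ū''' = ā(x̄)³ ū`. -/
def canonicalRHS (abar : ℝ → ℝ) : Jet2 → ℝ := fun z => abar z.1 ^ 3 * z.2.1

/-- The coefficient `ā` is smooth and nowhere zero on the open set `S`. -/
structure IsCoefficient (S : Set ℝ) (abar : ℝ → ℝ) : Prop where
  isOpen : IsOpen S
  smooth : ContDiffOn ℝ ∞ abar S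
  ne_zero : ∀ s ∈ S, abar s ≠ 0

/-- On `Ω`, the equation `u''' = f` is taken to `ū''' = ā(x̄)³ ū`, `x̄ ∈ S`, by the contact
transformation `(φ, ψ, χ)` with contact factor `lam`. -/
structure LinearizesTo (f : Jet2 → ℝ) (Ω : Set Jet2) (S : Set ℝ) (abar : ℝ → ℝ)
    (φ ψ χ lam : Jet1 → ℝ) : Prop where
  coefficient : IsCoefficient S abar
  mapsTo : Set.MapsTo φ (proj '' Ω) S
  contact : IsContactTransformation (proj '' Ω) φ ψ χ lam
  transforms : TransformsODE f Ω (canonicalRHS abar) φ ψ χ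

/-- The five systems for smooth functions `H, b, a₁, φ, χ, ψ` of `(x, u, p)` and `η` of
`(x, u, p, q)` on `V`. Here `b` stands for `ā(x̄)`, so `f̄ = ā(x̄)³ ū` is `b³ ψ`. -/
structure SolvesSystems (f : Jet2 → ℝ) (V : Set Jet2) (H b a₁ φ : Jet1 → ℝ) (η : Jet2 → ℝ)
    (χ ψ : Jet1 → ℝ) : Prop where
  smooth_H : ContDiffOn ℝ ∞ H (proj '' V)
  smooth_b : ContDiffOn ℝ ∞ b (proj '' V)
  smooth_a₁ : ContDiffOn ℝ ∞ a₁ (proj '' V)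
  smooth_φ : ContDiffOn ℝ ∞ φ (proj '' V)
  smooth_η : ContDiffOn ℝ ∞ η V
  smooth_χ : ContDiffOn ℝ ∞ χ (proj '' V)
  smooth_ψ : ContDiffOn ℝ ∞ ψ (proj '' V)
  b_ne_zero : ∀ y ∈ proj '' V, b y ≠ 0
  a₁_ne_zero : ∀ y ∈ proj '' V, a₁ y ≠ 0
  -- the Riccati-type equation for `H`
  H_eq : ∀ z ∈ V, -(2 / J3 f z) * Dhat f (lift H) z + lift H z ^ 2 = K f z
  -- the equation for `b`
  b_eq : ∀ z ∈ V, Dhat f (lift b) z = -(J3 f z * lift H z) * lift b z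
  -- the system for `a₁`
  a₁_x : ∀ z ∈ V, Dhat f (lift a₁) z = J3 f z * (lift H z + I5 f z) * lift a₁ z
  a₁_u : ∀ z ∈ V, pdu (lift a₁) z = (lift H z * I7 f z - Q f z) * lift a₁ z
  a₁_p : ∀ z ∈ V, pdp (lift a₁) z =
    (I4 f z * (lift H z + I5 f z) - I7 f z / J3 f z) * lift a₁ z
  a₁_q : ∀ z ∈ V, pdq (lift a₁) z = 0
  -- the system for `φ`
  φ_x : ∀ z ∈ V, Dhat f (lift φ) z = -(J3 f z / lift b z)
  φ_u : ∀ z ∈ V, pdu (lift φ) z = -(I7 f z / lift b z)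
  φ_p : ∀ z ∈ V, pdp (lift φ) z = -(I4 f z / lift b z)
  -- the system for `η`
  η_x : ∀ z ∈ V, Dhat f η z = -(J3 f z / lift b z) * (lift b z ^ 3 * lift ψ z)
  η_u : ∀ z ∈ V, pdu η z =
    ((lift H z + I5 f z) ^ 2 / 2 + I2 f z / (2 * J3 f z ^ 2)) * lift b z ^ 2 * lift a₁ z
      - (I7 f z / lift b z) * (lift b z ^ 3 * lift ψ z)
  η_p : ∀ z ∈ V, pdp η z =
    ((lift H z + I5 f z) / J3 f z + I1 f z / (3 * J3 f z ^ 2)) * lift b z ^ 2 * lift a₁ z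
      - (I4 f z / lift b z) * (lift b z ^ 3 * lift ψ z)
  η_q : ∀ z ∈ V, pdq η z = lift b z ^ 2 * lift a₁ z / J3 f z ^ 2
  -- the system for `χ`
  χ_x : ∀ z ∈ V, Dhat f (lift χ) z = -(J3 f z / lift b z) * η z
  χ_u : ∀ z ∈ V, pdu (lift χ) z =
    -(lift H z + I5 f z) * lift b z * lift a₁ z - (I7 f z / lift b z) * η z
  χ_p : ∀ z ∈ V, pdp (lift χ) z =
    -(lift b z * lift a₁ z / J3 f z) - (I4 f z / lift b z) * η z
  -- the system for `ψ`
  ψ_D : ∀ z ∈ V, I7 f z * Dhat f (lift ψ) z = J3 f z * (pdu (lift ψ) z - lift a₁ z)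
  ψ_x : ∀ z ∈ V, pdx (lift ψ) z = lift χ z * pdx (lift φ) z - z.2.2.1 * lift a₁ z
  ψ_p : ∀ z ∈ V, pdp (lift ψ) z = -(I4 f z / lift b z) * lift χ z
  -- the relations `χ = D̂ₓψ / D̂ₓφ` and `η = D̂ₓχ / D̂ₓφ`
  χ_eq : ∀ z ∈ V, lift χ z = Dhat f (lift ψ) z / Dhat f (lift φ) z
  η_eq : ∀ z ∈ V, η z = Dhat f (lift χ) z / Dhat f (lift φ) z

end

end ThirdOrderODE

open ThirdOrderODE

/-! Pull back the contact forms of the target: `dψ - χ dφ`, `dχ - η dφ` and `dη - b³ψ dφ` are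
combinations of `du - p dx`, `dp - q dx`, `dq - f dx`, and `Dhat_coeffQ`, `Dhat_coeffP`,
`Dhat_coeffU` give the total derivatives of their coefficients. Put R = D̂ₓφ, g = η_q and σ =
D̂ₓa₁/a₁. These equations force a₁ = gR², express the other coefficients through g, R, σ, I₁, I₂
(`coeffP_η_and_Dhat_R`, `coeffU_η_and_Dhat_σ`) and give a Riccati equation for σ. In the last
equation σ cancels and I₃ = (-Rb)³ remains (`I3_eq`), so J₃ = -Rb is non-zero. Its logarithmic
derivative gives J₃(H + I₅) = σ. Derivatives in q then identify I₄ and I₇ with -bφ_p and -bφ_u, the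
Riccati equation becomes system 1, and the commutators of ∂_q and ∂_p with D̂ₓ give (a₁)_p and
(a₁)_u.

Conversely, systems 4 and 5 contain the contact condition, the Jacobian and the target equation
algebraically, which settles the case of a prescribed ā. For ā to exist, db = H b² dφ is needed,
while the systems only give this along D̂ₓ. Since b, H, φ do not depend on q, applying ∂_q extends
it to ∂_p, and applying D̂ₓ to the result extends it to ∂_u (`fderiv_b`), provided D̂ₓH / D̂ₓφ = b(K
- H²)/2 is independent of q. Here the given transformation is used again: it shows K_q = 0, a
property of f alone (`K_q`). Straightening φ then makes b locally a smooth function of φ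
(`exists_comp_of_fderiv_eq_mul`). -/

namespace ThirdOrderODE

/-! ### Derivatives on open sets: product rules and symmetric second derivatives. -/

section Calculus

variable {E : Type*} [NormedAddCommGroup E] [NormedSpace ℝ E]

theorem fderiv_congr_of_isOpen {s : Set E} (hs : IsOpen s) {F G : E → ℝ}
    (h : ∀ w ∈ s, F w = G w) {z : E} (hz : z ∈ s) (v : E) :
    fderiv ℝ F z v = fderiv ℝ G z v := by
  have : F =ᶠ[nhds z] G := by
    filter_upwards [hs.mem_nhds hz] with w hw using h w hw
  rw [this.fderiv_eq]

theorem differentiableAt_of_contDiffOn {s : Set E} (hs : IsOpen s) {F : E → ℝ}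
    (hF : ContDiffOn ℝ ∞ F s) {z : E} (hz : z ∈ s) : DifferentiableAt ℝ F z :=
  (hF.contDiffAt (hs.mem_nhds hz)).differentiableAt (by simp)

theorem fderiv_add_apply' {F G : E → ℝ} {z : E} (hF : DifferentiableAt ℝ F z)
    (hG : DifferentiableAt ℝ G z) (v : E) :
    fderiv ℝ (fun w => F w + G w) z v = fderiv ℝ F z v + fderiv ℝ G z v := by
  rw [(hF.hasFDerivAt.fun_add hG.hasFDerivAt).fderiv]; simp

theorem fderiv_mul_apply' {F G : E → ℝ} {z : E} (hF : DifferentiableAt ℝ F z)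
    (hG : DifferentiableAt ℝ G z) (v : E) :
    fderiv ℝ (fun w => F w * G w) z v = F z * fderiv ℝ G z v + G z * fderiv ℝ F z v := by
  rw [(hF.hasFDerivAt.fun_mul hG.hasFDerivAt).fderiv]; simp

/-- The product rule for a function given as a product on an open set. -/
theorem fderiv_of_eq_mul {s : Set E} (hs : IsOpen s) {A F G : E → ℝ}
    (hF : ContDiffOn ℝ ∞ F s) (hG : ContDiffOn ℝ ∞ G s)
    (h : ∀ w ∈ s, A w = F w * G w) {z : E} (hz : z ∈ s) (v : E) :
    fderiv ℝ A z v = F z * fderiv ℝ G z v + G z * fderiv ℝ F z v := by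
  rw [fderiv_congr_of_isOpen hs h hz]
  exact fderiv_mul_apply' (differentiableAt_of_contDiffOn hs hF hz)
    (differentiableAt_of_contDiffOn hs hG hz) v

/-- The derivative of a function given as `L + F G` on an open set. -/
theorem fderiv_of_eq_add_mul {s : Set E} (hs : IsOpen s) {A L F G : E → ℝ}
    (hL : ContDiffOn ℝ ∞ L s) (hF : ContDiffOn ℝ ∞ F s) (hG : ContDiffOn ℝ ∞ G s)
    (h : ∀ w ∈ s, A w = L w + F w * G w) {z : E} (hz : z ∈ s) (v : E) :
    fderiv ℝ A z v = fderiv ℝ L z v + (F z * fderiv ℝ G z v + G z * fderiv ℝ F z v) := by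
  rw [fderiv_congr_of_isOpen hs h hz]
  have hF' := differentiableAt_of_contDiffOn hs hF hz
  have hG' := differentiableAt_of_contDiffOn hs hG hz
  rw [fderiv_add_apply' (differentiableAt_of_contDiffOn hs hL hz) (hF'.fun_mul hG'),
    fderiv_mul_apply' hF' hG']

theorem contDiffOn_fderiv_apply {s : Set E} (hs : IsOpen s) {F : E → ℝ}
    (hF : ContDiffOn ℝ ∞ F s) {X : E → E} (hX : ContDiffOn ℝ ∞ X s) :
    ContDiffOn ℝ ∞ (fun w => fderiv ℝ F w (X w)) s :=
  (hF.fderiv_of_isOpen hs (by simp)).clm_apply hX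

/-- The derivative of `X F` for a vector field `X`. -/
theorem fderiv_fderiv_apply {s : Set E} (hs : IsOpen s) {F : E → ℝ}
    (hF : ContDiffOn ℝ ∞ F s) {X : E → E} {X' : E →L[ℝ] E} {z : E} (hz : z ∈ s)
    (hX : HasFDerivAt X X' z) (v : E) :
    fderiv ℝ (fun w => fderiv ℝ F w (X w)) z v =
      fderiv ℝ (fun w => fderiv ℝ F w v) z (X z) + fderiv ℝ F z (X' v) := by
  have h1 : ContDiffOn ℝ ∞ (fderiv ℝ F) s := hF.fderiv_of_isOpen hs (by simp)
  have h2 : HasFDerivAt (fderiv ℝ F) (fderiv ℝ (fderiv ℝ F) z) z :=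
    ((h1.contDiffAt (hs.mem_nhds hz)).differentiableAt (by simp)).hasFDerivAt
  -- Symmetry exchanges the two directions: v(XF) = X(vF) + (vX)F for constant v.
  have hsymm : IsSymmSndFDerivAt ℝ F z :=
    (hF.contDiffAt (hs.mem_nhds hz)).isSymmSndFDerivAt
      (by simpa using ENat.LEInfty.out)
  rw [(h2.clm_apply hX).fderiv, (h2.clm_apply (hasFDerivAt_const v z)).fderiv]
  simp [hsymm.eq v (X z), add_comm]

end Calculus

/-! ### The total derivative and its commutators with ∂_q, ∂_p, ∂_u. -/

/-- The vector field `D̂ₓ`. -/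
def hatField (f : Jet2 → ℝ) (z : Jet2) : Jet2 := (1, z.2.2.1, z.2.2.2, f z)

theorem fderiv_apply_eq (F : Jet2 → ℝ) (z v : Jet2) :
    fderiv ℝ F z v = v.1 * pdx F z + v.2.1 * pdu F z + v.2.2.1 * pdp F z + v.2.2.2 * pdq F z := by
  obtain ⟨a, b, c, d⟩ := v
  have : ((a, b, c, d) : Jet2) = a • ((1, 0, 0, 0) : Jet2) + b • ((0, 1, 0, 0) : Jet2)
      + c • ((0, 0, 1, 0) : Jet2) + d • ((0, 0, 0, 1) : Jet2) := by
    simp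
  rw [this]
  simp only [map_add, map_smul, smul_eq_mul]
  simp [pdx, pdu, pdp, pdq]

theorem Dhat_eq (f F : Jet2 → ℝ) (z : Jet2) : Dhat f F z = fderiv ℝ F z (hatField f z) := by
  rw [fderiv_apply_eq]; simp [Dhat, hatField]

theorem Dhat_eq' (f F : Jet2 → ℝ) : Dhat f F = fun z => fderiv ℝ F z (hatField f z) :=
  funext (Dhat_eq f F)

section Smooth

variable {Ω : Set Jet2} {f F : Jet2 → ℝ}

theorem contDiffOn_pdu (hΩ : IsOpen Ω) (hF : ContDiffOn ℝ ∞ F Ω) : ContDiffOn ℝ ∞ (pdu F) Ω :=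
  contDiffOn_fderiv_apply hΩ hF contDiffOn_const

theorem contDiffOn_pdp (hΩ : IsOpen Ω) (hF : ContDiffOn ℝ ∞ F Ω) : ContDiffOn ℝ ∞ (pdp F) Ω :=
  contDiffOn_fderiv_apply hΩ hF contDiffOn_const

theorem contDiffOn_pdq (hΩ : IsOpen Ω) (hF : ContDiffOn ℝ ∞ F Ω) : ContDiffOn ℝ ∞ (pdq F) Ω :=
  contDiffOn_fderiv_apply hΩ hF contDiffOn_const

theorem contDiffOn_hatField (hf : ContDiffOn ℝ ∞ f Ω) : ContDiffOn ℝ ∞ (hatField f) Ω := by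
  unfold hatField; fun_prop

theorem contDiffOn_Dhat (hΩ : IsOpen Ω) (hf : ContDiffOn ℝ ∞ f Ω) (hF : ContDiffOn ℝ ∞ F Ω) :
    ContDiffOn ℝ ∞ (Dhat f F) Ω := by
  rw [Dhat_eq']
  exact contDiffOn_fderiv_apply hΩ hF (contDiffOn_hatField hf)

/-- The commutator of a constant vector field with `D̂ₓ`. -/
theorem fderiv_Dhat (hΩ : IsOpen Ω) (hf : ContDiffOn ℝ ∞ f Ω) (hF : ContDiffOn ℝ ∞ F Ω)
    {z : Jet2} (hz : z ∈ Ω) (v : Jet2) :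
    fderiv ℝ (Dhat f F) z v = Dhat f (fun w => fderiv ℝ F w v) z
      + fderiv ℝ F z (0, v.2.2.1, v.2.2.2, fderiv ℝ f z v) := by
  have hid := hasFDerivAt_id (𝕜 := ℝ) z
  have hX : HasFDerivAt (hatField f) _ z := (hasFDerivAt_const (1 : ℝ) z).prodMk
    (hid.snd.snd.fst.prodMk (hid.snd.snd.snd.prodMk
      (differentiableAt_of_contDiffOn hΩ hf hz).hasFDerivAt))
  rw [Dhat_eq', fderiv_fderiv_apply hΩ hF hz hX, Dhat_eq]
  simp

theorem pdq_Dhat (hΩ : IsOpen Ω) (hf : ContDiffOn ℝ ∞ f Ω) (hF : ContDiffOn ℝ ∞ F Ω)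
    {z : Jet2} (hz : z ∈ Ω) :
    pdq (Dhat f F) z = Dhat f (pdq F) z + pdp F z + pdq f z * pdq F z := by
  have h := fderiv_Dhat hΩ hf hF hz (0, 0, 0, 1)
  rw [fderiv_apply_eq F] at h
  change pdq (Dhat f F) z = Dhat f (pdq F) z + (0 * _ + _ * _ + _ * _ + pdq f z * _) at h
  linear_combination h

theorem pdp_Dhat (hΩ : IsOpen Ω) (hf : ContDiffOn ℝ ∞ f Ω) (hF : ContDiffOn ℝ ∞ F Ω)
    {z : Jet2} (hz : z ∈ Ω) :
    pdp (Dhat f F) z = Dhat f (pdp F) z + pdu F z + pdp f z * pdq F z := by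
  have h := fderiv_Dhat hΩ hf hF hz (0, 0, 1, 0)
  rw [fderiv_apply_eq F] at h
  change pdp (Dhat f F) z = Dhat f (pdp F) z + (0 * _ + _ * _ + _ * _ + pdp f z * _) at h
  linear_combination h

theorem pdu_Dhat (hΩ : IsOpen Ω) (hf : ContDiffOn ℝ ∞ f Ω) (hF : ContDiffOn ℝ ∞ F Ω)
    {z : Jet2} (hz : z ∈ Ω) :
    pdu (Dhat f F) z = Dhat f (pdu F) z + pdu f z * pdq F z := by
  have h := fderiv_Dhat hΩ hf hF hz (0, 1, 0, 0)
  rw [fderiv_apply_eq F] at h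
  change pdu (Dhat f F) z = Dhat f (pdu F) z + (0 * _ + _ * _ + _ * _ + pdu f z * _) at h
  linear_combination h

end Smooth

/-! ### Functions of (x, u, p) on the second jet space. -/

section Lift

theorem hasFDerivAt_proj (z : Jet2) : ∃ P : Jet2 →L[ℝ] Jet1, HasFDerivAt proj P z ∧
    ∀ v, P v = proj v := by
  have hid := hasFDerivAt_id (𝕜 := ℝ) z
  exact ⟨_, hid.fst.prodMk (hid.snd.fst.prodMk hid.snd.snd.fst), fun v => by simp [proj]⟩

theorem contDiff_proj : ContDiff ℝ ∞ proj := by unfold proj; fun_prop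

theorem isOpen_proj_image {Ω : Set Jet2} (hΩ : IsOpen Ω) : IsOpen (proj '' Ω) := by
  rw [isOpen_iff_mem_nhds]
  rintro _ ⟨z, hz, rfl⟩
  have hc : Continuous fun y : Jet1 => ((y.1, y.2.1, y.2.2, z.2.2.2) : Jet2) := by fun_prop
  filter_upwards [(hΩ.preimage hc).mem_nhds (show proj z ∈ _ from hz)] with y hy
  exact ⟨_, hy, rfl⟩

variable {Ω : Set Jet2} {F : Jet1 → ℝ}

theorem contDiffOn_lift (hF : ContDiffOn ℝ ∞ F (proj '' Ω)) : ContDiffOn ℝ ∞ (lift F) Ω :=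
  hF.comp contDiff_proj.contDiffOn fun z hz => ⟨z, hz, rfl⟩

theorem fderiv_lift {z : Jet2} (hF : DifferentiableAt ℝ F (proj z)) (v : Jet2) :
    fderiv ℝ (lift F) z v = fderiv ℝ F (proj z) (proj v) := by
  obtain ⟨P, hP, hPv⟩ := hasFDerivAt_proj z
  have : HasFDerivAt (lift F) _ z := HasFDerivAt.comp z hF.hasFDerivAt hP
  rw [this.fderiv]
  simp [hPv]

theorem pdq_lift {z : Jet2} (hF : DifferentiableAt ℝ F (proj z)) : pdq (lift F) z = 0 := by
  rw [pdq, fderiv_lift hF]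
  exact map_zero _

end Lift

section Derivations

variable {E : Type*} [NormedAddCommGroup E] [NormedSpace ℝ E]

theorem fderiv_of_eq_add_const_mul {s : Set E} (hs : IsOpen s) {A F G : E → ℝ} (c : ℝ)
    (hF : ContDiffOn ℝ ∞ F s) (hG : ContDiffOn ℝ ∞ G s)
    (h : ∀ w ∈ s, A w = F w + c * G w) {z : E} (hz : z ∈ s) (v : E) :
    fderiv ℝ A z v = fderiv ℝ F z v + c * fderiv ℝ G z v := by
  rw [fderiv_of_eq_add_mul hs hF contDiffOn_const hG h hz]
  simp

theorem fderiv_eq_zero_of_isOpen {s : Set E} (hs : IsOpen s) {A : E → ℝ}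
    (h : ∀ w ∈ s, A w = 0) {z : E} (hz : z ∈ s) (v : E) : fderiv ℝ A z v = 0 := by
  rw [fderiv_congr_of_isOpen hs h hz]
  simp

variable {Ω : Set Jet2} {f A F G L : Jet2 → ℝ} {z : Jet2}

theorem Dhat_congr (hΩ : IsOpen Ω) (h : ∀ w ∈ Ω, F w = G w) (hz : z ∈ Ω) :
    Dhat f F z = Dhat f G z := by
  simp only [Dhat_eq, fderiv_congr_of_isOpen hΩ h hz]

theorem Dhat_eq_zero (hΩ : IsOpen Ω) (h : ∀ w ∈ Ω, F w = 0) (hz : z ∈ Ω) :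
    Dhat f F z = 0 := by
  rw [Dhat_eq, fderiv_eq_zero_of_isOpen hΩ h hz]

theorem Dhat_of_eq_mul (hΩ : IsOpen Ω) (hF : ContDiffOn ℝ ∞ F Ω) (hG : ContDiffOn ℝ ∞ G Ω)
    (h : ∀ w ∈ Ω, A w = F w * G w) (hz : z ∈ Ω) :
    Dhat f A z = F z * Dhat f G z + G z * Dhat f F z := by
  simp only [Dhat_eq, fderiv_of_eq_mul hΩ hF hG h hz]

theorem Dhat_of_eq_add_const_mul (hΩ : IsOpen Ω) (c : ℝ) (hF : ContDiffOn ℝ ∞ F Ω)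
    (hG : ContDiffOn ℝ ∞ G Ω) (h : ∀ w ∈ Ω, A w = F w + c * G w) (hz : z ∈ Ω) :
    Dhat f A z = Dhat f F z + c * Dhat f G z := by
  simp only [Dhat_eq, fderiv_of_eq_add_const_mul hΩ c hF hG h hz]

/-- `[∂_p, ∂_u] = 0` and its analogues. -/
theorem fderiv_fderiv_comm (hΩ : IsOpen Ω) (hF : ContDiffOn ℝ ∞ F Ω) (hz : z ∈ Ω)
    (v w : Jet2) : fderiv ℝ (fun y => fderiv ℝ F y w) z v =
      fderiv ℝ (fun y => fderiv ℝ F y v) z w := by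
  rw [fderiv_fderiv_apply hΩ hF hz (hasFDerivAt_const w z)]
  simp

theorem pdq_pdu_eq_zero (hΩ : IsOpen Ω) (hF : ContDiffOn ℝ ∞ F Ω)
    (h : ∀ w ∈ Ω, pdq F w = 0) (hz : z ∈ Ω) : pdq (pdu F) z = 0 :=
  (fderiv_fderiv_comm hΩ hF hz _ _).trans (fderiv_eq_zero_of_isOpen hΩ h hz _)

end Derivations

/-! ### Structure equations in the contact coframe. -/

/-- The coefficient of `dA - B dΦ` along `du - p dx`. -/
noncomputable def coeffU (A B Φ : Jet2 → ℝ) (z : Jet2) : ℝ := pdu A z - B z * pdu Φ z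

/-- The coefficient of `dA - B dΦ` along `dp - q dx`. -/
noncomputable def coeffP (A B Φ : Jet2 → ℝ) (z : Jet2) : ℝ := pdp A z - B z * pdp Φ z

/-- The coefficient of `dA - B dΦ` along `dq - f dx`. -/
noncomputable def coeffQ (A B Φ : Jet2 → ℝ) (z : Jet2) : ℝ := pdq A z - B z * pdq Φ z

section Coefficients

variable {Ω : Set Jet2} {f A B C Φ : Jet2 → ℝ}

theorem contDiffOn_coeffU (hΩ : IsOpen Ω) (hA : ContDiffOn ℝ ∞ A Ω) (hB : ContDiffOn ℝ ∞ B Ω)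
    (hΦ : ContDiffOn ℝ ∞ Φ Ω) : ContDiffOn ℝ ∞ (coeffU A B Φ) Ω :=
  (contDiffOn_pdu hΩ hA).sub (hB.mul (contDiffOn_pdu hΩ hΦ))

theorem contDiffOn_coeffP (hΩ : IsOpen Ω) (hA : ContDiffOn ℝ ∞ A Ω) (hB : ContDiffOn ℝ ∞ B Ω)
    (hΦ : ContDiffOn ℝ ∞ Φ Ω) : ContDiffOn ℝ ∞ (coeffP A B Φ) Ω :=
  (contDiffOn_pdp hΩ hA).sub (hB.mul (contDiffOn_pdp hΩ hΦ))

theorem fderiv_sub_mul {E : Type*} [NormedAddCommGroup E] [NormedSpace ℝ E] {F G L : E → ℝ} {z : E}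
    (hL : DifferentiableAt ℝ L z) (hF : DifferentiableAt ℝ F z) (hG : DifferentiableAt ℝ G z)
    (v : E) : fderiv ℝ (fun w => L w - F w * G w) z v =
      fderiv ℝ L z v - (F z * fderiv ℝ G z v + G z * fderiv ℝ F z v) := by
  rw [(hL.hasFDerivAt.fun_sub (hF.hasFDerivAt.fun_mul hG.hasFDerivAt)).fderiv]; simp

/-- The structure equations of `dA - B dΦ` when `D̂ₓA = B D̂ₓΦ` and `D̂ₓB = C D̂ₓΦ`. -/
theorem Dhat_coeff (hΩ : IsOpen Ω) (hf : ContDiffOn ℝ ∞ f Ω) (hA : ContDiffOn ℝ ∞ A Ω)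
    (hB : ContDiffOn ℝ ∞ B Ω) (hΦ : ContDiffOn ℝ ∞ Φ Ω)
    (hAB : ∀ z ∈ Ω, Dhat f A z = B z * Dhat f Φ z)
    (hBC : ∀ z ∈ Ω, Dhat f B z = C z * Dhat f Φ z) {z : Jet2} (hz : z ∈ Ω) (v : Jet2) :
    Dhat f (fun w => fderiv ℝ A w v - B w * fderiv ℝ Φ w v) z =
      Dhat f Φ z * (fderiv ℝ B z v - C z * fderiv ℝ Φ z v)
      - (fderiv ℝ A z (0, v.2.2.1, v.2.2.2, fderiv ℝ f z v)
        - B z * fderiv ℝ Φ z (0, v.2.2.1, v.2.2.2, fderiv ℝ f z v)) := by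
  have hv : ∀ {F : Jet2 → ℝ}, ContDiffOn ℝ ∞ F Ω →
      DifferentiableAt ℝ (fun w => fderiv ℝ F w v) z := fun hF =>
    differentiableAt_of_contDiffOn hΩ (contDiffOn_fderiv_apply hΩ hF contDiffOn_const) hz
  rw [Dhat_eq, fderiv_sub_mul (hv hA) (differentiableAt_of_contDiffOn hΩ hB hz) (hv hΦ)]
  simp only [← Dhat_eq]
  -- D̂ₓA = B D̂ₓΦ is differentiated in the direction v, and v is commuted past D̂ₓ on both sides.
  have h1 := fderiv_of_eq_mul hΩ hB (contDiffOn_Dhat hΩ hf hΦ) hAB hz v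
  have h2 := fderiv_Dhat hΩ hf hA hz v
  have h3 := fderiv_Dhat hΩ hf hΦ hz v
  have h4 := hBC z hz
  linear_combination -h2 + h1 + B z * h3 - fderiv ℝ Φ z v * h4

/-- The brackets of ∂_q, ∂_p, ∂_u with D̂ₓ are ∂_p + f_q ∂_q, ∂_u + f_p ∂_q and f_u ∂_q. Each
coefficient therefore brings in the next lower one, here and in the two companions below. -/
theorem Dhat_coeffQ (hΩ : IsOpen Ω) (hf : ContDiffOn ℝ ∞ f Ω) (hA : ContDiffOn ℝ ∞ A Ω)
    (hB : ContDiffOn ℝ ∞ B Ω) (hΦ : ContDiffOn ℝ ∞ Φ Ω)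
    (hAB : ∀ z ∈ Ω, Dhat f A z = B z * Dhat f Φ z)
    (hBC : ∀ z ∈ Ω, Dhat f B z = C z * Dhat f Φ z) {z : Jet2} (hz : z ∈ Ω) :
    Dhat f (coeffQ A B Φ) z =
      Dhat f Φ z * coeffQ B C Φ z - coeffP A B Φ z - pdq f z * coeffQ A B Φ z := by
  have h := Dhat_coeff hΩ hf hA hB hΦ hAB hBC hz (0, 0, 0, 1)
  rw [fderiv_apply_eq A z (_, _, _, _), fderiv_apply_eq Φ z (0, 0, 1, _)] at h
  change Dhat f (coeffQ A B Φ) z = Dhat f Φ z * coeffQ B C Φ z -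
    ((0 * _ + 0 * _ + 1 * _ + pdq f z * _) - _ * (0 * _ + 0 * _ + 1 * _ + pdq f z * _)) at h
  rw [h]; simp only [coeffP, coeffQ]; ring

theorem Dhat_coeffP (hΩ : IsOpen Ω) (hf : ContDiffOn ℝ ∞ f Ω) (hA : ContDiffOn ℝ ∞ A Ω)
    (hB : ContDiffOn ℝ ∞ B Ω) (hΦ : ContDiffOn ℝ ∞ Φ Ω)
    (hAB : ∀ z ∈ Ω, Dhat f A z = B z * Dhat f Φ z)
    (hBC : ∀ z ∈ Ω, Dhat f B z = C z * Dhat f Φ z) {z : Jet2} (hz : z ∈ Ω) :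
    Dhat f (coeffP A B Φ) z =
      Dhat f Φ z * coeffP B C Φ z - coeffU A B Φ z - pdp f z * coeffQ A B Φ z := by
  have h := Dhat_coeff hΩ hf hA hB hΦ hAB hBC hz (0, 0, 1, 0)
  rw [fderiv_apply_eq A z (_, _, _, _), fderiv_apply_eq Φ z (0, 1, 0, _)] at h
  change Dhat f (coeffP A B Φ) z = Dhat f Φ z * coeffP B C Φ z -
    ((0 * _ + 1 * _ + 0 * _ + pdp f z * _) - _ * (0 * _ + 1 * _ + 0 * _ + pdp f z * _)) at h
  rw [h]; simp only [coeffU, coeffQ]; ring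

theorem Dhat_coeffU (hΩ : IsOpen Ω) (hf : ContDiffOn ℝ ∞ f Ω) (hA : ContDiffOn ℝ ∞ A Ω)
    (hB : ContDiffOn ℝ ∞ B Ω) (hΦ : ContDiffOn ℝ ∞ Φ Ω)
    (hAB : ∀ z ∈ Ω, Dhat f A z = B z * Dhat f Φ z)
    (hBC : ∀ z ∈ Ω, Dhat f B z = C z * Dhat f Φ z) {z : Jet2} (hz : z ∈ Ω) :
    Dhat f (coeffU A B Φ) z =
      Dhat f Φ z * coeffU B C Φ z - pdu f z * coeffQ A B Φ z := by
  have h := Dhat_coeff hΩ hf hA hB hΦ hAB hBC hz (0, 1, 0, 0)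
  rw [fderiv_apply_eq A z (_, _, _, _), fderiv_apply_eq Φ z (0, 0, 0, _)] at h
  change Dhat f (coeffU A B Φ) z = Dhat f Φ z * coeffU B C Φ z -
    ((0 * _ + 0 * _ + 0 * _ + pdu f z * _) - _ * (0 * _ + 0 * _ + 0 * _ + pdu f z * _)) at h
  rw [h]; simp only [coeffQ]; ring

end Coefficients

/-! ### Consequences of a linearization, up to the formula for I₃. -/

/-- A linearizing contact transformation, lifted to the second jet space: `Λ` is the contact
factor, `η` the prolongation, and `B = ā(Φ)`, with `dB = H B² dΦ`, `dH = G dΦ`. -/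
structure LinearizingData (f : Jet2 → ℝ) (Ω : Set Jet2) (Φ Ψ Χ Λ η B H G : Jet2 → ℝ) : Prop where
  isOpen : IsOpen Ω
  smooth_f : ContDiffOn ℝ ∞ f Ω
  smooth_Φ : ContDiffOn ℝ ∞ Φ Ω
  smooth_Ψ : ContDiffOn ℝ ∞ Ψ Ω
  smooth_Χ : ContDiffOn ℝ ∞ Χ Ω
  smooth_Λ : ContDiffOn ℝ ∞ Λ Ω
  smooth_η : ContDiffOn ℝ ∞ η Ω
  smooth_B : ContDiffOn ℝ ∞ B Ω
  smooth_H : ContDiffOn ℝ ∞ H Ω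
  smooth_G : ContDiffOn ℝ ∞ G Ω
  Φ_q : ∀ z ∈ Ω, pdq Φ z = 0
  Ψ_q : ∀ z ∈ Ω, pdq Ψ z = 0
  Χ_q : ∀ z ∈ Ω, pdq Χ z = 0
  Λ_q : ∀ z ∈ Ω, pdq Λ z = 0
  G_q : ∀ z ∈ Ω, pdq G z = 0
  Φ_ne : ∀ z ∈ Ω, Dhat f Φ z ≠ 0
  Λ_ne : ∀ z ∈ Ω, Λ z ≠ 0
  B_ne : ∀ z ∈ Ω, B z ≠ 0
  dB : ∀ z ∈ Ω, ∀ v, fderiv ℝ B z v = H z * B z ^ 2 * fderiv ℝ Φ z v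
  dH : ∀ z ∈ Ω, ∀ v, fderiv ℝ H z v = G z * fderiv ℝ Φ z v
  Ψ_D : ∀ z ∈ Ω, Dhat f Ψ z = Χ z * Dhat f Φ z
  Χ_D : ∀ z ∈ Ω, Dhat f Χ z = η z * Dhat f Φ z
  η_D : ∀ z ∈ Ω, Dhat f η z = (B z ^ 3 * Ψ z) * Dhat f Φ z
  Ψ_p : ∀ z ∈ Ω, coeffP Ψ Χ Φ z = 0
  Ψ_u : ∀ z ∈ Ω, coeffU Ψ Χ Φ z = Λ z

namespace LinearizingData

variable {f : Jet2 → ℝ} {Ω : Set Jet2} {Φ Ψ Χ Λ η B H G : Jet2 → ℝ} {z : Jet2}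

theorem coeffQ_Ψ (d : LinearizingData f Ω Φ Ψ Χ Λ η B H G) (hz : z ∈ Ω) :
    coeffQ Ψ Χ Φ z = 0 := by
  simp [coeffQ, d.Ψ_q z hz, d.Φ_q z hz]

theorem coeffQ_Χ (d : LinearizingData f Ω Φ Ψ Χ Λ η B H G) (hz : z ∈ Ω) :
    coeffQ Χ η Φ z = 0 := by
  simp [coeffQ, d.Χ_q z hz, d.Φ_q z hz]

theorem coeffQ_η (d : LinearizingData f Ω Φ Ψ Χ Λ η B H G) (F : Jet2 → ℝ) (hz : z ∈ Ω) :
    coeffQ η F Φ z = pdq η z := by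
  simp [coeffQ, d.Φ_q z hz]

theorem smooth_R (d : LinearizingData f Ω Φ Ψ Χ Λ η B H G) : ContDiffOn ℝ ∞ (Dhat f Φ) Ω :=
  contDiffOn_Dhat d.isOpen d.smooth_f d.smooth_Φ

theorem smooth_g (d : LinearizingData f Ω Φ Ψ Χ Λ η B H G) : ContDiffOn ℝ ∞ (pdq η) Ω :=
  contDiffOn_pdq d.isOpen d.smooth_η

theorem smooth_coeffP_Χ (d : LinearizingData f Ω Φ Ψ Χ Λ η B H G) :
    ContDiffOn ℝ ∞ (coeffP Χ η Φ) Ω :=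
  contDiffOn_coeffP d.isOpen d.smooth_Χ d.smooth_η d.smooth_Φ

theorem smooth_coeffU_Χ (d : LinearizingData f Ω Φ Ψ Χ Λ η B H G) :
    ContDiffOn ℝ ∞ (coeffU Χ η Φ) Ω :=
  contDiffOn_coeffU d.isOpen d.smooth_Χ d.smooth_η d.smooth_Φ

theorem smooth_F (d : LinearizingData f Ω Φ Ψ Χ Λ η B H G) :
    ContDiffOn ℝ ∞ (fun w => B w ^ 3 * Ψ w) Ω :=
  (d.smooth_B.pow 3).mul d.smooth_Ψ

/-- The p-coefficient of `dΨ - Χ dΦ` vanishes identically, so its structure equation is an algebraic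
relation. The same happens in `coeffP_Χ_eq` with the q-coefficient of `dΧ - η dΦ`. -/
theorem Λ_eq (d : LinearizingData f Ω Φ Ψ Χ Λ η B H G) (hz : z ∈ Ω) :
    Λ z = coeffP Χ η Φ z * Dhat f Φ z := by
  have h := Dhat_coeffP d.isOpen d.smooth_f d.smooth_Ψ d.smooth_Χ d.smooth_Φ d.Ψ_D d.Χ_D hz
  rw [Dhat_eq_zero d.isOpen d.Ψ_p hz, d.coeffQ_Ψ hz, d.Ψ_u z hz] at h
  linear_combination h

theorem Dhat_Λ (d : LinearizingData f Ω Φ Ψ Χ Λ η B H G) (hz : z ∈ Ω) :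
    Dhat f Λ z = Dhat f Φ z * coeffU Χ η Φ z := by
  have h := Dhat_coeffU d.isOpen d.smooth_f d.smooth_Ψ d.smooth_Χ d.smooth_Φ d.Ψ_D d.Χ_D hz
  rw [Dhat_congr d.isOpen d.Ψ_u hz, d.coeffQ_Ψ hz] at h
  linear_combination h

theorem coeffP_Χ_eq (d : LinearizingData f Ω Φ Ψ Χ Λ η B H G) (hz : z ∈ Ω) :
    coeffP Χ η Φ z = pdq η z * Dhat f Φ z := by
  have h := Dhat_coeffQ d.isOpen d.smooth_f d.smooth_Χ d.smooth_η d.smooth_Φ d.Χ_D d.η_D hz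
  rw [Dhat_eq_zero d.isOpen (fun w hw => d.coeffQ_Χ hw) hz, d.coeffQ_Χ hz, d.coeffQ_η _ hz] at h
  linear_combination h

theorem Dhat_coeffP_Χ (d : LinearizingData f Ω Φ Ψ Χ Λ η B H G) (hz : z ∈ Ω) :
    Dhat f (coeffP Χ η Φ) z =
      Dhat f Φ z * coeffP η (fun w => B w ^ 3 * Ψ w) Φ z - coeffU Χ η Φ z := by
  have h := Dhat_coeffP d.isOpen d.smooth_f d.smooth_Χ d.smooth_η d.smooth_Φ d.Χ_D d.η_D hz
  rw [d.coeffQ_Χ hz] at h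
  linear_combination h

theorem Dhat_coeffU_Χ (d : LinearizingData f Ω Φ Ψ Χ Λ η B H G) (hz : z ∈ Ω) :
    Dhat f (coeffU Χ η Φ) z = Dhat f Φ z * coeffU η (fun w => B w ^ 3 * Ψ w) Φ z := by
  have h := Dhat_coeffU d.isOpen d.smooth_f d.smooth_Χ d.smooth_η d.smooth_Φ d.Χ_D d.η_D hz
  rw [d.coeffQ_Χ hz] at h
  linear_combination h

theorem fderiv_F (d : LinearizingData f Ω Φ Ψ Χ Λ η B H G) (hz : z ∈ Ω) (v : Jet2) :
    fderiv ℝ (fun w => B w ^ 3 * Ψ w) z v = B z ^ 3 * fderiv ℝ Ψ z v +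
      3 * B z ^ 4 * H z * Ψ z * fderiv ℝ Φ z v := by
  have hB := differentiableAt_of_contDiffOn d.isOpen d.smooth_B hz
  have hΨ := differentiableAt_of_contDiffOn d.isOpen d.smooth_Ψ hz
  rw [((hB.hasFDerivAt.pow 3).fun_mul hΨ.hasFDerivAt).fderiv]
  simp [d.dB z hz v]
  ring

/-- This supplies the multiplier `C` needed to apply the structure equations to `dη - B³Ψ dΦ`. -/
theorem Dhat_F (d : LinearizingData f Ω Φ Ψ Χ Λ η B H G) (hz : z ∈ Ω) :
    Dhat f (fun w => B w ^ 3 * Ψ w) z =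
      (B z ^ 3 * Χ z + 3 * B z ^ 4 * H z * Ψ z) * Dhat f Φ z := by
  have h := d.Ψ_D z hz
  rw [Dhat_eq] at h
  rw [Dhat_eq, d.fderiv_F hz, h, ← Dhat_eq]
  ring

theorem Dhat_g (d : LinearizingData f Ω Φ Ψ Χ Λ η B H G) (hz : z ∈ Ω) :
    Dhat f (pdq η) z = -coeffP η (fun w => B w ^ 3 * Ψ w) Φ z + I1 f z * pdq η z := by
  have h := Dhat_coeffQ d.isOpen d.smooth_f d.smooth_η d.smooth_F d.smooth_Φ d.η_D
    (fun w hw => d.Dhat_F hw) hz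
  rw [Dhat_congr d.isOpen (fun w hw => d.coeffQ_η _ hw) hz, d.coeffQ_η _ hz] at h
  -- With F = B³Ψ and C the multiplier from `Dhat_F`, `dF - C dΦ = B³ (dΨ - Χ dΦ)`, whose
  -- coefficients along `du - p dx`, `dp - q dx`, `dq - f dx` are B³Λ, 0, 0.
  have h2 : coeffQ (fun w => B w ^ 3 * Ψ w)
      (fun z => B z ^ 3 * Χ z + 3 * B z ^ 4 * H z * Ψ z) Φ z = 0 := by
    have := d.fderiv_F hz (0, 0, 0, 1)
    change pdq _ z = _ * pdq Ψ z + _ * pdq Φ z at this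
    rw [coeffQ, this, d.Ψ_q z hz, d.Φ_q z hz]; ring
  rw [h2] at h
  rw [I1]
  linear_combination h

theorem Dhat_coeffP_η (d : LinearizingData f Ω Φ Ψ Χ Λ η B H G) (hz : z ∈ Ω) :
    Dhat f (coeffP η (fun w => B w ^ 3 * Ψ w) Φ) z =
      -coeffU η (fun w => B w ^ 3 * Ψ w) Φ z - pdp f z * pdq η z := by
  have h := Dhat_coeffP d.isOpen d.smooth_f d.smooth_η d.smooth_F d.smooth_Φ d.η_D
    (fun w hw => d.Dhat_F hw) hz
  rw [d.coeffQ_η _ hz] at h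
  have h2 : coeffP (fun w => B w ^ 3 * Ψ w)
      (fun z => B z ^ 3 * Χ z + 3 * B z ^ 4 * H z * Ψ z) Φ z = 0 := by
    have := d.fderiv_F hz (0, 0, 1, 0)
    change pdp _ z = _ * pdp Ψ z + _ * pdp Φ z at this
    have h3 := d.Ψ_p z hz
    rw [coeffP] at h3
    rw [coeffP, this]; linear_combination B z ^ 3 * h3
  rw [h2] at h
  linear_combination h

theorem Dhat_coeffU_η (d : LinearizingData f Ω Φ Ψ Χ Λ η B H G) (hz : z ∈ Ω) :
    Dhat f (coeffU η (fun w => B w ^ 3 * Ψ w) Φ) z =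
      Dhat f Φ z * B z ^ 3 * Λ z - pdu f z * pdq η z := by
  have h := Dhat_coeffU d.isOpen d.smooth_f d.smooth_η d.smooth_F d.smooth_Φ d.η_D
    (fun w hw => d.Dhat_F hw) hz
  rw [d.coeffQ_η _ hz] at h
  have h2 : coeffU (fun w => B w ^ 3 * Ψ w)
      (fun z => B z ^ 3 * Χ z + 3 * B z ^ 4 * H z * Ψ z) Φ z = B z ^ 3 * Λ z := by
    have := d.fderiv_F hz (0, 1, 0, 0)
    change pdu _ z = _ * pdu Ψ z + _ * pdu Φ z at this
    have h3 := d.Ψ_u z hz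
    rw [coeffU] at h3
    rw [coeffU, this]; linear_combination B z ^ 3 * h3
  rw [h2] at h
  linear_combination h

/-- The logarithmic derivative `D̂ₓΛ / Λ` of the contact factor is smooth. -/
theorem smooth_σ (d : LinearizingData f Ω Φ Ψ Χ Λ η B H G) :
    ContDiffOn ℝ ∞ (fun w => Dhat f Λ w / Λ w) Ω :=
  (contDiffOn_Dhat d.isOpen d.smooth_f d.smooth_Λ).div d.smooth_Λ d.Λ_ne

theorem g_ne (d : LinearizingData f Ω Φ Ψ Χ Λ η B H G) (hz : z ∈ Ω) : pdq η z ≠ 0 := by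
  intro h
  apply d.Λ_ne z hz
  rw [d.Λ_eq hz, d.coeffP_Χ_eq hz, h]; ring

theorem σ_mul (d : LinearizingData f Ω Φ Ψ Χ Λ η B H G) (hz : z ∈ Ω) :
    Dhat f Λ z = Dhat f Λ z / Λ z * Λ z := by
  field_simp [d.Λ_ne z hz]

theorem coeffU_Χ_eq (d : LinearizingData f Ω Φ Ψ Χ Λ η B H G) (hz : z ∈ Ω) :
    coeffU Χ η Φ z = coeffP Χ η Φ z * (Dhat f Λ z / Λ z) := by
  have h1 := d.σ_mul hz
  have h2 := d.Λ_eq hz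
  apply mul_left_cancel₀ (d.Φ_ne z hz)
  rw [← d.Dhat_Λ hz]
  linear_combination h1 + Dhat f Λ z / Λ z * h2

/-- Let β be the p-coefficient of `dΧ - η dΦ`. Applying D̂ₓ to Λ = βR and to β = gR gives two linear
equations for D̂ₓR and the p-coefficient γ of `dη - B³Ψ dΦ`. -/
theorem coeffP_η_and_Dhat_R (d : LinearizingData f Ω Φ Ψ Χ Λ η B H G) (hz : z ∈ Ω) :
    coeffP η (fun w => B w ^ 3 * Ψ w) Φ z = pdq η z * (Dhat f Λ z / Λ z + 1 / 3 * I1 f z) ∧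
    Dhat f (Dhat f Φ) z = Dhat f Φ z * (Dhat f Λ z / Λ z - 1 / 3 * I1 f z) := by
  have h1 := Dhat_of_eq_mul (f := f) (A := Λ) d.isOpen d.smooth_coeffP_Χ d.smooth_R
    (fun w hw => d.Λ_eq hw) hz
  have h2 := Dhat_of_eq_mul (f := f) d.isOpen d.smooth_g d.smooth_R
    (fun w hw => d.coeffP_Χ_eq hw) hz
  have h3 := d.Dhat_coeffP_Χ hz
  have h4 := d.Dhat_g hz
  have h5 := d.coeffU_Χ_eq hz
  have h6 := d.coeffP_Χ_eq hz
  have h7 := d.σ_mul hz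
  have h8 := d.Λ_eq hz
  have hR := d.Φ_ne z hz
  have hg := d.g_ne hz
  generalize Dhat f Λ z / Λ z = σ at *
  generalize Dhat f (Dhat f Φ) z = DR at *
  generalize coeffP η (fun w => B w ^ 3 * Ψ w) Φ z = γ at *
  generalize Dhat f (coeffP Χ η Φ) z = Dβ at *
  generalize Dhat f (pdq η) z = Dg at *
  generalize pdq η z = g at *
  generalize coeffP Χ η Φ z = β at *
  generalize coeffU Χ η Φ z = β' at *
  generalize Dhat f Φ z = R at *
  subst h4 h6 h5 h3
  rw [h7, h8] at h1
  have e1 : σ * (g * R) = g * DR + (R * γ - g * R * σ) := by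
    apply mul_left_cancel₀ hR; linear_combination h1
  -- Eliminating `g * DR` leaves 3Rγ, the source of the factor 1/3.
  have e2 : γ = g * (σ + 1 / 3 * I1 f z) := by
    apply mul_left_cancel₀ hR; linear_combination 1 / 3 * (h2 - e1)
  refine ⟨e2, ?_⟩
  apply mul_left_cancel₀ hg
  subst e2
  linear_combination -e1

theorem coeffP_η_eq (d : LinearizingData f Ω Φ Ψ Χ Λ η B H G) (hz : z ∈ Ω) :
    coeffP η (fun w => B w ^ 3 * Ψ w) Φ z = pdq η z * (Dhat f Λ z / Λ z + 1 / 3 * I1 f z) :=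
  (d.coeffP_η_and_Dhat_R hz).1

theorem Dhat_R (d : LinearizingData f Ω Φ Ψ Χ Λ η B H G) (hz : z ∈ Ω) :
    Dhat f (Dhat f Φ) z = Dhat f Φ z * (Dhat f Λ z / Λ z - 1 / 3 * I1 f z) :=
  (d.coeffP_η_and_Dhat_R hz).2

theorem smooth_I1 (d : LinearizingData f Ω Φ Ψ Χ Λ η B H G) : ContDiffOn ℝ ∞ (I1 f) Ω :=
  (contDiffOn_pdq d.isOpen d.smooth_f).neg

theorem smooth_I2 (d : LinearizingData f Ω Φ Ψ Χ Λ η B H G) : ContDiffOn ℝ ∞ (I2 f) Ω :=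
  ((contDiffOn_const.mul (d.smooth_I1.pow 2)).sub (contDiffOn_pdp d.isOpen d.smooth_f)).sub
    (contDiffOn_const.mul (contDiffOn_Dhat d.isOpen d.smooth_f d.smooth_I1))

/-- Applying D̂ₓ to the formulas for the u-coefficient of `dΧ - η dΦ` and the p-coefficient of `dη -
B³Ψ dΦ` yields two relations; eliminating the u-coefficient of `dη - B³Ψ dΦ` gives a Riccati
equation for σ. The spelling with a product and `1 * I2 f z` fits the product rule and
`Dhat_of_eq_add_const_mul`. -/
theorem coeffU_η_and_Dhat_σ (d : LinearizingData f Ω Φ Ψ Χ Λ η B H G) (hz : z ∈ Ω) :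
    coeffU η (fun w => B w ^ 3 * Ψ w) Φ z =
      pdq η z * ((1 / 2) * ((Dhat f Λ z / Λ z) * (Dhat f Λ z / Λ z) + 1 * I2 f z)) ∧
    2 * Dhat f (fun w => Dhat f Λ w / Λ w) z =
      (Dhat f Λ z / Λ z) ^ 2 - 2 / 3 * (Dhat f Λ z / Λ z) * I1 f z + I2 f z := by
  have h1 := Dhat_of_eq_mul (f := f) d.isOpen d.smooth_coeffP_Χ d.smooth_σ
    (fun w hw => d.coeffU_Χ_eq hw) hz
  have h2 := Dhat_of_eq_mul (f := f) d.isOpen d.smooth_g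
    (d.smooth_σ.add (contDiffOn_const.mul d.smooth_I1)) (fun w hw => d.coeffP_η_eq hw) hz
  have h3 := Dhat_of_eq_add_const_mul (f := f) d.isOpen (1 / 3) d.smooth_σ d.smooth_I1
    (fun w _ => rfl) hz
  have h4 := d.Dhat_coeffU_Χ hz
  have h5 := d.Dhat_coeffP_η hz
  have h6 := d.Dhat_coeffP_Χ hz
  have h7 := d.Dhat_g hz
  have h8 := d.coeffP_η_eq hz
  have h9 := d.coeffU_Χ_eq hz
  have h10 := d.coeffP_Χ_eq hz
  have hI : I2 f z = -(2 / 9) * I1 f z ^ 2 - pdp f z - (1 / 3) * Dhat f (I1 f) z := rfl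
  have hR := d.Φ_ne z hz
  have hg := d.g_ne hz
  rw [h3] at h2
  generalize Dhat f (fun w => Dhat f Λ w / Λ w) z = Dσ at *
  generalize Dhat f Λ z / Λ z = σ at *
  rw [h4, h6, h9, h8, h10] at h1
  rw [h5, h7, h8] at h2
  have e1 : coeffU η (fun w => B w ^ 3 * Ψ w) Φ z = pdq η z * (Dσ + 1 / 3 * σ * I1 f z) := by
    apply mul_left_cancel₀ hR; linear_combination h1
  rw [e1] at h2 ⊢
  have e2 : 2 * Dσ = σ ^ 2 - 2 / 3 * σ * I1 f z + I2 f z := by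
    apply mul_left_cancel₀ hg; rw [hI]; linear_combination -h2
  exact ⟨by linear_combination 1 / 2 * pdq η z * e2, e2⟩

theorem coeffU_η_eq (d : LinearizingData f Ω Φ Ψ Χ Λ η B H G) (hz : z ∈ Ω) :
    coeffU η (fun w => B w ^ 3 * Ψ w) Φ z =
      pdq η z * ((1 / 2) * ((Dhat f Λ z / Λ z) * (Dhat f Λ z / Λ z) + 1 * I2 f z)) :=
  (d.coeffU_η_and_Dhat_σ hz).1

theorem Dhat_σ (d : LinearizingData f Ω Φ Ψ Χ Λ η B H G) (hz : z ∈ Ω) :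
    2 * Dhat f (fun w => Dhat f Λ w / Λ w) z =
      (Dhat f Λ z / Λ z) ^ 2 - 2 / 3 * (Dhat f Λ z / Λ z) * I1 f z + I2 f z :=
  (d.coeffU_η_and_Dhat_σ hz).2

/-- D̂ₓ of the u-coefficient g(σ² + I₂)/2 is computed in two ways. By the Riccati equation every σ
cancels, leaving g I₃ = -R B³ Λ = -g (RB)³. Here I₃ is minus the Wünschmann invariant of the
equation. -/
theorem I3_eq (d : LinearizingData f Ω Φ Ψ Χ Λ η B H G) (hz : z ∈ Ω) :
    I3 f z = (-(Dhat f Φ z * B z)) ^ 3 := by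
  have hsσ := d.smooth_σ.mul d.smooth_σ
  have hs2 := hsσ.add (contDiffOn_const (c := (1 : ℝ)).mul d.smooth_I2)
  have h1 := Dhat_of_eq_mul (f := f) d.isOpen d.smooth_g
    (contDiffOn_const (c := (1 / 2 : ℝ)).mul hs2) (fun w hw => d.coeffU_η_eq hw) hz
  have h2 := Dhat_of_eq_mul (f := f) d.isOpen (contDiffOn_const (c := (1 / 2 : ℝ))) hs2
    (fun w _ => rfl) hz
  have h3 := Dhat_of_eq_add_const_mul (f := f) d.isOpen 1 hsσ d.smooth_I2 (fun w _ => rfl) hz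
  have h4 := Dhat_of_eq_mul (f := f) d.isOpen d.smooth_σ d.smooth_σ (fun w _ => rfl) hz
  have h5 := d.Dhat_coeffU_η hz
  have h6 := d.Dhat_σ hz
  have h7 := d.Dhat_g hz
  have h8 := d.coeffP_η_eq hz
  have h9 := d.Λ_eq hz
  have h10 := d.coeffP_Χ_eq hz
  have hc : Dhat f (fun _ => (1 / 2 : ℝ)) z = 0 := by simp [Dhat_eq]
  have hI : I3 f z = -(1 / 3) * I1 f z * I2 f z - pdu f z - (1 / 2) * Dhat f (I2 f) z := rfl
  rw [h2, hc, h3, h4, h5, h7, h8] at h1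
  generalize Dhat f (fun w => Dhat f Λ w / Λ w) z = Dσ at *
  generalize Dhat f Λ z / Λ z = σ at *
  apply mul_left_cancel₀ (d.g_ne hz)
  rw [h9, h10] at h1
  rw [hI]
  linear_combination h1 + 1 / 2 * pdq η z * σ * h6

end LinearizingData

/-! ### The invariants J₃, I₄, I₅, I₇, K and Q in terms of the transformation. -/

theorem cbrt_pow (r : ℝ) : cbrt (r ^ 3) = r :=
  (Odd.strictMono_pow (by decide : Odd 3)).injective (cbrt_pow_three (r ^ 3))

theorem fderiv_of_eq_neg_mul {E : Type*} [NormedAddCommGroup E] [NormedSpace ℝ E] {s : Set E}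
    (hs : IsOpen s) {A F G : E → ℝ} (hF : ContDiffOn ℝ ∞ F s) (hG : ContDiffOn ℝ ∞ G s)
    (h : ∀ w ∈ s, A w = -(F w * G w)) {z : E} (hz : z ∈ s) (v : E) :
    fderiv ℝ A z v = -(F z * fderiv ℝ G z v + G z * fderiv ℝ F z v) := by
  rw [fderiv_of_eq_mul hs hF.neg hG (fun w hw => (h w hw).trans (by simp)) hz v, fderiv_fun_neg]
  simp
  ring

namespace LinearizingData

variable {f : Jet2 → ℝ} {Ω : Set Jet2} {Φ Ψ Χ Λ η B H G : Jet2 → ℝ} {z : Jet2}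

theorem I3_ne (d : LinearizingData f Ω Φ Ψ Χ Λ η B H G) (hz : z ∈ Ω) : I3 f z ≠ 0 := by
  rw [d.I3_eq hz]
  exact pow_ne_zero _ (neg_ne_zero.2 (mul_ne_zero (d.Φ_ne z hz) (d.B_ne z hz)))

theorem J3_eq (d : LinearizingData f Ω Φ Ψ Χ Λ η B H G) (hz : z ∈ Ω) :
    J3 f z = -(Dhat f Φ z * B z) := by
  rw [J3, d.I3_eq hz, cbrt_pow]

theorem J3_ne (d : LinearizingData f Ω Φ Ψ Χ Λ η B H G) (hz : z ∈ Ω) : J3 f z ≠ 0 := by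
  rw [d.J3_eq hz]
  exact neg_ne_zero.2 (mul_ne_zero (d.Φ_ne z hz) (d.B_ne z hz))

/-- Smoothness is read off the product formula, which avoids the cube root. -/
theorem smooth_J3 (d : LinearizingData f Ω Φ Ψ Χ Λ η B H G) : ContDiffOn ℝ ∞ (J3 f) Ω :=
  (d.smooth_R.mul d.smooth_B).neg.congr fun _ hw => d.J3_eq hw

theorem Φ_D (d : LinearizingData f Ω Φ Ψ Χ Λ η B H G) (hz : z ∈ Ω) :
    Dhat f Φ z = -(J3 f z / B z) := by
  have := d.B_ne z hz
  rw [d.J3_eq hz]; field_simp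

theorem fderiv_J3 (d : LinearizingData f Ω Φ Ψ Χ Λ η B H G) (hz : z ∈ Ω) (v : Jet2) :
    fderiv ℝ (J3 f) z v = -(Dhat f Φ z * (H z * B z ^ 2 * fderiv ℝ Φ z v)
      + B z * fderiv ℝ (Dhat f Φ) z v) := by
  rw [fderiv_of_eq_neg_mul d.isOpen d.smooth_R d.smooth_B (fun w hw => d.J3_eq hw) hz, d.dB z hz]

theorem B_q (d : LinearizingData f Ω Φ Ψ Χ Λ η B H G) (hz : z ∈ Ω) : pdq B z = 0 := by
  have h := d.Φ_q z hz
  rw [pdq] at h ⊢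
  rw [d.dB z hz, h, mul_zero]

theorem H_q (d : LinearizingData f Ω Φ Ψ Χ Λ η B H G) (hz : z ∈ Ω) : pdq H z = 0 := by
  have h := d.Φ_q z hz
  rw [pdq] at h ⊢
  rw [d.dH z hz, h, mul_zero]

theorem R_q (d : LinearizingData f Ω Φ Ψ Χ Λ η B H G) (hz : z ∈ Ω) :
    pdq (Dhat f Φ) z = pdp Φ z := by
  rw [pdq_Dhat d.isOpen d.smooth_f d.smooth_Φ hz, Dhat_eq_zero d.isOpen d.Φ_q hz, d.Φ_q z hz]
  ring

theorem I4_eq (d : LinearizingData f Ω Φ Ψ Χ Λ η B H G) (hz : z ∈ Ω) :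
    I4 f z = -(B z * pdp Φ z) := by
  have h := d.fderiv_J3 hz (0, 0, 0, 1)
  change pdq (J3 f) z = -(_ * (_ * pdq Φ z) + _ * pdq (Dhat f Φ) z) at h
  rw [I4, h, d.R_q hz, d.Φ_q z hz]; ring

theorem Φ_p (d : LinearizingData f Ω Φ Ψ Χ Λ η B H G) (hz : z ∈ Ω) :
    pdp Φ z = -(I4 f z / B z) := by
  have := d.B_ne z hz
  rw [d.I4_eq hz]; field_simp

theorem B_D (d : LinearizingData f Ω Φ Ψ Χ Λ η B H G) (hz : z ∈ Ω) :
    Dhat f B z = -(J3 f z * H z) * B z := by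
  rw [Dhat_eq, d.dB z hz, ← Dhat_eq, d.J3_eq hz]; ring

theorem H_D (d : LinearizingData f Ω Φ Ψ Χ Λ η B H G) (hz : z ∈ Ω) :
    Dhat f H z = G z * Dhat f Φ z := by
  rw [Dhat_eq, d.dH z hz, ← Dhat_eq]

theorem J3_D (d : LinearizingData f Ω Φ Ψ Χ Λ η B H G) (hz : z ∈ Ω) :
    Dhat f (J3 f) z = J3 f z * (Dhat f Λ z / Λ z - 1 / 3 * I1 f z) - J3 f z ^ 2 * H z := by
  rw [Dhat_eq, d.fderiv_J3 hz, ← Dhat_eq, ← Dhat_eq, d.Dhat_R hz, d.J3_eq hz]; ring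

/-- By definition J₃I₅ = I₁/3 + D̂ₓJ₃/J₃, and J₃ = -RB has logarithmic derivative σ - I₁/3 - J₃H. -/
theorem J3_mul_I5 (d : LinearizingData f Ω Φ Ψ Χ Λ η B H G) (hz : z ∈ Ω) :
    J3 f z * (H z + I5 f z) = Dhat f Λ z / Λ z := by
  have h : I5 f z = (1 / (3 * J3 f z ^ 2)) * (I1 f z * J3 f z + 3 * Dhat f (J3 f) z) := rfl
  rw [h, d.J3_D hz]
  have hJ := d.J3_ne hz
  generalize Dhat f Λ z / Λ z = σ
  field_simp
  ring

theorem smooth_I5 (d : LinearizingData f Ω Φ Ψ Χ Λ η B H G) : ContDiffOn ℝ ∞ (I5 f) Ω := by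
  refine ((d.smooth_σ.div d.smooth_J3 fun w hw => d.J3_ne hw).sub d.smooth_H).congr
    fun w hw => ?_
  change I5 f w = Dhat f Λ w / Λ w / J3 f w - H w
  rw [← d.J3_mul_I5 hw, mul_div_cancel_left₀ _ (d.J3_ne hw)]
  ring

theorem smooth_H_add_I5 (d : LinearizingData f Ω Φ Ψ Χ Λ η B H G) :
    ContDiffOn ℝ ∞ (fun w => H w + I5 f w) Ω :=
  d.smooth_H.add d.smooth_I5

theorem Λ_D (d : LinearizingData f Ω Φ Ψ Χ Λ η B H G) (hz : z ∈ Ω) :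
    Dhat f Λ z = J3 f z * (H z + I5 f z) * Λ z := by
  rw [d.J3_mul_I5 hz, ← d.σ_mul hz]

theorem fderiv_H_add_I5 (d : LinearizingData f Ω Φ Ψ Χ Λ η B H G) (hz : z ∈ Ω) (v : Jet2) :
    fderiv ℝ (fun w => H w + I5 f w) z v = G z * fderiv ℝ Φ z v + fderiv ℝ (I5 f) z v := by
  rw [fderiv_add_apply' (differentiableAt_of_contDiffOn d.isOpen d.smooth_H hz)
    (differentiableAt_of_contDiffOn d.isOpen d.smooth_I5 hz), d.dH z hz]

theorem coeffU_Χ_eq_I5 (d : LinearizingData f Ω Φ Ψ Χ Λ η B H G) (hz : z ∈ Ω) :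
    coeffU Χ η Φ z = -((H z + I5 f z) * (B z * Λ z)) := by
  apply mul_left_cancel₀ (d.Φ_ne z hz)
  rw [← d.Dhat_Λ hz, d.Λ_D hz, d.J3_eq hz]; ring

theorem fderiv_coeffU_Χ (d : LinearizingData f Ω Φ Ψ Χ Λ η B H G) (hz : z ∈ Ω) (v : Jet2) :
    fderiv ℝ (coeffU Χ η Φ) z v = -((H z + I5 f z) * (B z * fderiv ℝ Λ z v
        + Λ z * (H z * B z ^ 2 * fderiv ℝ Φ z v))
      + B z * Λ z * (G z * fderiv ℝ Φ z v + fderiv ℝ (I5 f) z v)) := by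
  rw [fderiv_of_eq_neg_mul d.isOpen d.smooth_H_add_I5 (d.smooth_B.mul d.smooth_Λ)
    (fun w hw => d.coeffU_Χ_eq_I5 hw) hz, d.fderiv_H_add_I5 hz,
    fderiv_of_eq_mul d.isOpen d.smooth_B d.smooth_Λ (fun w _ => rfl) hz, d.dB z hz]

/-- In Χ_u - ηΦ_u only η depends on q. -/
theorem pdq_coeffU_Χ (d : LinearizingData f Ω Φ Ψ Χ Λ η B H G) (hz : z ∈ Ω) :
    pdq (coeffU Χ η Φ) z = -(pdq η z * pdu Φ z) := by
  have h := fderiv_sub_mul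
    (differentiableAt_of_contDiffOn d.isOpen (contDiffOn_pdu d.isOpen d.smooth_Χ) hz)
    (differentiableAt_of_contDiffOn d.isOpen d.smooth_η hz)
    (differentiableAt_of_contDiffOn d.isOpen (contDiffOn_pdu d.isOpen d.smooth_Φ) hz)
    (0, 0, 0, 1)
  change pdq (coeffU Χ η Φ) z = pdq (pdu Χ) z - (_ * pdq (pdu Φ) z + _ * pdq η z) at h
  rw [h, pdq_pdu_eq_zero d.isOpen d.smooth_Χ d.Χ_q hz,
    pdq_pdu_eq_zero d.isOpen d.smooth_Φ d.Φ_q hz]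
  ring

theorem Λ_eq_g (d : LinearizingData f Ω Φ Ψ Χ Λ η B H G) (hz : z ∈ Ω) :
    Λ z = pdq η z * Dhat f Φ z ^ 2 := by
  rw [d.Λ_eq hz, d.coeffP_Χ_eq hz]; ring

/-- The q-derivative of the u-coefficient of `dΧ - η dΦ` is computed twice; in its form -(H + I₅)BΛ
only I₅ depends on q. -/
theorem I7_eq (d : LinearizingData f Ω Φ Ψ Χ Λ η B H G) (hz : z ∈ Ω) :
    I7 f z = -(B z * pdu Φ z) := by
  have h := d.fderiv_coeffU_Χ hz (0, 0, 0, 1)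
  change pdq (coeffU Χ η Φ) z = -(_ * (_ * pdq Λ z + _ * (_ * pdq Φ z))
    + _ * (_ * pdq Φ z + pdq (I5 f) z)) at h
  rw [d.pdq_coeffU_Χ hz, d.Λ_q z hz, d.Φ_q z hz, d.Λ_eq_g hz] at h
  rw [I7, d.J3_eq hz]
  apply mul_left_cancel₀ (d.g_ne hz)
  linear_combination -B z * h

theorem Φ_u (d : LinearizingData f Ω Φ Ψ Χ Λ η B H G) (hz : z ∈ Ω) :
    pdu Φ z = -(I7 f z / B z) := by
  have := d.B_ne z hz
  rw [d.I7_eq hz]; field_simp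

/-- This is the Riccati equation of `Dhat_σ` with σ = J₃(H + I₅) substituted. -/
theorem K_eq (d : LinearizingData f Ω Φ Ψ Χ Λ η B H G) (hz : z ∈ Ω) :
    -(2 / J3 f z) * Dhat f H z + H z ^ 2 = K f z := by
  have h1 := Dhat_of_eq_mul (f := f) d.isOpen d.smooth_J3 d.smooth_H_add_I5
    (fun w hw => (d.J3_mul_I5 hw).symm) hz
  have h2 := d.fderiv_H_add_I5 hz (hatField f z)
  rw [← d.dH z hz] at h2
  simp only [← Dhat_eq] at h2
  have h3 := d.Dhat_σ hz
  have h4 := d.J3_D hz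
  have hJ := d.J3_ne hz
  rw [← d.J3_mul_I5 hz] at h3 h4
  rw [h1, h2] at h3
  have hK : K f z = (2 * J3 f z * Dhat f (I5 f) z - I2 f z + J3 f z ^ 2 * I5 f z ^ 2) /
    J3 f z ^ 2 := rfl
  rw [hK]
  field_simp
  linear_combination -h3 + 2 * (H z + I5 f z) * h4

theorem K_eq_G (d : LinearizingData f Ω Φ Ψ Χ Λ η B H G) (hz : z ∈ Ω) :
    K f z * B z = 2 * G z + H z ^ 2 * B z := by
  have hR := d.Φ_ne z hz
  have hB := d.B_ne z hz
  rw [← d.K_eq hz, d.H_D hz, d.J3_eq hz]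
  field_simp

theorem smooth_K (d : LinearizingData f Ω Φ Ψ Χ Λ η B H G) : ContDiffOn ℝ ∞ (K f) Ω := by
  refine ((((contDiffOn_const (c := (2 : ℝ))).mul d.smooth_G).div d.smooth_B d.B_ne).add
    (d.smooth_H.pow 2)).congr fun w hw => ?_
  have hB := d.B_ne w hw
  have := d.K_eq_G hw
  change K f w = 2 * G w / B w + H w ^ 2
  field_simp
  linear_combination this

/-- K = H² + 2G/B, and none of H, G, B depends on q. The converse relies on this constraint on f. -/
theorem K_q (d : LinearizingData f Ω Φ Ψ Χ Λ η B H G) (hz : z ∈ Ω) : pdq (K f) z = 0 := by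
  have h1 := fderiv_of_eq_mul d.isOpen d.smooth_K d.smooth_B (fun w _ => rfl) hz (0, 0, 0, 1)
  have h2 := fderiv_of_eq_add_mul (A := fun w => K f w * B w) d.isOpen
    (contDiffOn_const (c := (2 : ℝ)) |>.mul d.smooth_G) (d.smooth_H.pow 2) d.smooth_B
    (fun w hw => d.K_eq_G hw) hz (0, 0, 0, 1)
  have h3 := fderiv_of_eq_mul d.isOpen (contDiffOn_const (c := (2 : ℝ))) d.smooth_G
    (fun w _ => rfl) hz (0, 0, 0, 1)
  have h4 := fderiv_of_eq_mul d.isOpen d.smooth_H d.smooth_H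
    (fun w _ => pow_two (H w)) hz (0, 0, 0, 1)
  have hc : fderiv ℝ (fun _ : Jet2 => (2 : ℝ)) z (0, 0, 0, 1) = 0 := by simp
  rw [h2, h3, h4, hc] at h1
  change 2 * pdq G z + _ * 0 + (_ * pdq B z + _ * (_ * pdq H z + _ * pdq H z)) =
    _ * pdq B z + _ * pdq (K f) z at h1
  rw [d.G_q z hz, d.B_q hz, d.H_q hz] at h1
  have h5 : B z * pdq (K f) z = 0 := by linear_combination -h1
  exact (mul_eq_zero.1 h5).resolve_left (d.B_ne z hz)

/-- As Λ_q = 0, the bracket of ∂_q with D̂ₓ turns the q-derivative of D̂ₓΛ into Λ_p. -/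
theorem Λ_p_eq (d : LinearizingData f Ω Φ Ψ Χ Λ η B H G) (hz : z ∈ Ω) :
    pdp Λ z = pdp Φ z * coeffU Χ η Φ z - coeffP Χ η Φ z * pdu Φ z := by
  have h1 := pdq_Dhat d.isOpen d.smooth_f d.smooth_Λ hz
  have h2 := fderiv_of_eq_mul d.isOpen d.smooth_R d.smooth_coeffU_Χ
    (fun w hw => d.Dhat_Λ hw) hz (0, 0, 0, 1)
  change pdq (Dhat f Λ) z = _ * pdq (coeffU Χ η Φ) z + _ * pdq (Dhat f Φ) z at h2
  rw [Dhat_eq_zero d.isOpen d.Λ_q hz, d.Λ_q z hz, h2, d.pdq_coeffU_Χ hz, d.R_q hz] at h1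
  rw [d.coeffP_Χ_eq hz]
  linear_combination -h1

theorem Λ_p (d : LinearizingData f Ω Φ Ψ Χ Λ η B H G) (hz : z ∈ Ω) :
    pdp Λ z = (I4 f z * (H z + I5 f z) - I7 f z / J3 f z) * Λ z := by
  have hR := d.Φ_ne z hz
  have hB := d.B_ne z hz
  rw [d.Λ_p_eq hz, d.coeffU_Χ_eq_I5 hz, d.I4_eq hz, d.I7_eq hz, d.J3_eq hz, d.Λ_eq hz]
  field_simp

/-- As Λ_q = 0, Λ_u = ∂_p D̂ₓΛ - D̂ₓΛ_p, and both D̂ₓΛ and Λ_p are already known in terms of Φ and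
the coefficients of `dΧ - η dΦ`. -/
theorem Λ_u (d : LinearizingData f Ω Φ Ψ Χ Λ η B H G) (hz : z ∈ Ω) :
    pdu Λ z = (H z * I7 f z - Q f z) * Λ z := by
  have hu := contDiffOn_pdu d.isOpen d.smooth_Φ
  have hp := contDiffOn_pdp d.isOpen d.smooth_Φ
  have c1 := pdp_Dhat d.isOpen d.smooth_f d.smooth_Λ hz
  have c2 := pdp_Dhat d.isOpen d.smooth_f d.smooth_Φ hz
  have c3 := pdu_Dhat d.isOpen d.smooth_f d.smooth_Φ hz
  rw [d.Λ_q z hz] at c1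
  rw [d.Φ_q z hz] at c2 c3
  have h1 := fderiv_of_eq_mul d.isOpen d.smooth_R d.smooth_coeffU_Χ
    (fun w hw => d.Dhat_Λ hw) hz (0, 0, 1, 0)
  change pdp (Dhat f Λ) z = _ * pdp (coeffU Χ η Φ) z + _ * pdp (Dhat f Φ) z at h1
  have h2 : Dhat f (pdp Λ) z = pdp Φ z * Dhat f (coeffU Χ η Φ) z
      + coeffU Χ η Φ z * Dhat f (pdp Φ) z
      - (coeffP Χ η Φ z * Dhat f (pdu Φ) z + pdu Φ z * Dhat f (coeffP Χ η Φ) z) := by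
    rw [Dhat_eq, fderiv_congr_of_isOpen d.isOpen (fun w hw => d.Λ_p_eq hw) hz,
      fderiv_sub_mul (differentiableAt_of_contDiffOn d.isOpen (hp.mul d.smooth_coeffU_Χ) hz)
        (differentiableAt_of_contDiffOn d.isOpen d.smooth_coeffP_Χ hz)
        (differentiableAt_of_contDiffOn d.isOpen hu hz),
      fderiv_of_eq_mul d.isOpen hp d.smooth_coeffU_Χ (fun w _ => rfl) hz]
    simp only [← Dhat_eq]
  have h3 := d.fderiv_coeffU_Χ hz (0, 0, 1, 0)
  change pdp (coeffU Χ η Φ) z = -(_ * (_ * pdp Λ z + _ * (_ * pdp Φ z))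
    + _ * (_ * pdp Φ z + pdp (I5 f) z)) at h3
  have h4 := d.fderiv_coeffU_Χ hz (hatField f z)
  simp only [← Dhat_eq] at h4
  have h5 := d.Dhat_coeffP_Χ hz
  rw [d.coeffP_η_eq hz, d.coeffU_Χ_eq hz, d.coeffP_Χ_eq hz] at h5
  have h6 := d.fderiv_J3 hz (0, 1, 0, 0)
  change pdu (J3 f) z = -(_ * (_ * pdu Φ z) + _ * pdu (Dhat f Φ) z) at h6
  have hR := d.Φ_ne z hz
  have hB := d.B_ne z hz
  have hΛ := d.Λ_eq_g hz
  have hP := d.Λ_p_eq hz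
  have hD := d.Dhat_Λ hz
  have hU := d.coeffU_Χ_eq_I5 hz
  have hβ := d.coeffP_Χ_eq hz
  -- The G-terms from the p-derivative and the total derivative of `coeffU Χ η Φ` cancel.
  have key : Dhat f Φ z * pdu Λ z = Λ z * (-B z * Dhat f Φ z ^ 2 * pdp (I5 f) z
      + Dhat f Φ z * B z * pdp Φ z * Dhat f (I5 f) z + 1 / 3 * I1 f z * pdu Φ z
      + pdu (Dhat f Φ) z) := by
    have e : pdu Λ z = pdp (Dhat f Λ) z - Dhat f (pdp Λ) z := by linear_combination -c1
    rw [e, h1, h2, h3, h4, h5, hP, hD, c2, c3, hβ, hU, hΛ]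
    ring
  have hQ : Q f z = -((I1 f z * I7 f z + 3 * J3 f z ^ 2 * pdp (I5 f) z + 3 * pdu (J3 f) z
      - 3 * J3 f z * I4 f z * Dhat f (I5 f) z) / (3 * J3 f z)) := rfl
  rw [hQ, h6, d.I7_eq hz, d.I4_eq hz, d.J3_eq hz]
  apply mul_left_cancel₀ hR
  rw [key]
  field_simp
  ring

end LinearizingData

/-! ### Local functional dependence. -/

section FunctionalDependence

variable {E : Type*} [NormedAddCommGroup E] [NormedSpace ℝ E] [CompleteSpace E]

/-- If `db = g dφ` and `dφ ≠ 0` at a point, then `b` is locally a smooth function of `φ`. -/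
theorem exists_comp_of_fderiv_eq_mul {O : Set E} (hO : IsOpen O) {φ b g : E → ℝ}
    (hφ : ContDiffOn ℝ ∞ φ O) (hb : ContDiffOn ℝ ∞ b O)
    (hdb : ∀ y ∈ O, ∀ v, fderiv ℝ b y v = g y * fderiv ℝ φ y v)
    {y₀ : E} (hy₀ : y₀ ∈ O) {v₀ : E} (hv₀ : fderiv ℝ φ y₀ v₀ ≠ 0) :
    ∃ N : Set E, IsOpen N ∧ y₀ ∈ N ∧ N ⊆ O ∧ ∃ (S : Set ℝ) (a : ℝ → ℝ), IsOpen S ∧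
      ContDiffOn ℝ ∞ a S ∧ (∀ s ∈ S, ∃ y ∈ O, a s = b y) ∧ Set.MapsTo φ N S ∧
      ∀ y ∈ N, b y = a (φ y) := by
  obtain ⟨v, hv⟩ : ∃ v, fderiv ℝ φ y₀ v = 1 :=
    ⟨(fderiv ℝ φ y₀ v₀)⁻¹ • v₀, by simp [hv₀]⟩
  set l := fderiv ℝ φ y₀ with hl
  -- T corrects y along v, with l v = 1, so that φ ∘ T⁻¹ is affine with linear part l. Its
  -- derivative at y₀ is the identity.
  set T : E → E := fun y => y + (φ y - φ y₀ - l (y - y₀)) • v with hT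
  have hT₀ : T y₀ = y₀ := by simp [hT]
  have hlT : ∀ y, l (T y) = l y₀ + (φ y - φ y₀) := by
    intro y; simp [hT, hv]; ring
  have hTs : ContDiffOn ℝ ∞ T O := by
    refine contDiffOn_id.add (ContDiffOn.smul ?_ contDiffOn_const)
    exact (hφ.sub contDiffOn_const).sub (l.contDiff.contDiffOn.comp
      (contDiffOn_id.sub contDiffOn_const) (Set.mapsTo_univ _ _))
  have hφ₀ : HasFDerivAt φ l y₀ := (differentiableAt_of_contDiffOn hO hφ hy₀).hasFDerivAt
  have hT' : HasFDerivAt T ((ContinuousLinearEquiv.refl ℝ E : E ≃L[ℝ] E) : E →L[ℝ] E) y₀ := by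
    have h := (hasFDerivAt_id y₀).fun_add (((hφ₀.sub_const (φ y₀)).fun_sub
      (l.hasFDerivAt.comp y₀ ((hasFDerivAt_id y₀).sub_const y₀))).fun_smul
        (hasFDerivAt_const v y₀))
    refine h.congr_fderiv ?_
    ext w
    simp
  have hTat : ContDiffAt ℝ ∞ T y₀ := hTs.contDiffAt (hO.mem_nhds hy₀)
  set e := hTat.toOpenPartialHomeomorph T hT' (by simp) with he
  have hee : (e : E → E) = T := rfl
  have hsrc : y₀ ∈ e.source := hTat.mem_toOpenPartialHomeomorph_source hT' (by simp)
  -- Smoothness of T⁻¹ on a whole ball requires an invertible derivative at every point of it;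
  -- invertibility is an open condition.
  have hinv : ∀ᶠ y in nhds y₀, fderiv ℝ T y ∈
      Set.range ((↑) : (E ≃L[ℝ] E) → E →L[ℝ] E) := by
    have hc : ContinuousAt (fderiv ℝ T) y₀ :=
      ((hTs.fderiv_of_isOpen hO (m := ∞) (by simp)).continuousOn).continuousAt (hO.mem_nhds hy₀)
    refine hc.eventually_mem ?_
    rw [hT'.fderiv]
    exact ContinuousLinearEquiv.nhds _
  have hev : ∀ᶠ w in nhds y₀, w ∈ e.target ∧ e.symm w ∈ O ∧ fderiv ℝ T (e.symm w) ∈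
      Set.range ((↑) : (E ≃L[ℝ] E) → E →L[ℝ] E) := by
    have htgt : y₀ ∈ e.target := by
      have := e.map_source hsrc
      rwa [hee, hT₀] at this
    have hsymm : e.symm y₀ = y₀ := by
      have := e.left_inv hsrc
      rwa [hee, hT₀] at this
    have hc : Filter.Tendsto e.symm (nhds y₀) (nhds y₀) := by
      have := e.continuousAt_symm htgt
      rwa [ContinuousAt, hsymm] at this
    exact (show ∀ᶠ w in nhds y₀, w ∈ e.target from e.open_target.mem_nhds htgt).and (hc.eventually 
      ((show ∀ᶠ w in nhds y₀, w ∈ O from hO.mem_nhds hy₀).and hinv))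
  obtain ⟨r, hr, hball⟩ := Metric.eventually_nhds_iff_ball.1 hev
  set D := Metric.ball y₀ r with hD
  have hDo : IsOpen D := Metric.isOpen_ball
  have hsymm_smooth : ∀ w ∈ D, ContDiffAt ℝ ∞ e.symm w := by
    intro w hw
    obtain ⟨h1, h2, M, hM⟩ := hball w hw
    refine e.contDiffAt_symm h1 (f₀' := M) ?_ (hTs.contDiffAt (hO.mem_nhds h2))
    rw [hM]
    exact ((hTs.contDiffAt (hO.mem_nhds h2)).differentiableAt (by simp)).hasFDerivAt
  have hφe : ∀ w ∈ D, φ (e.symm w) = l w + (φ y₀ - l y₀) := by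
    intro w hw
    have h1 := hlT (e.symm w)
    rw [← hee, e.right_inv (hball w hw).1] at h1
    linear_combination -h1
  set F : E → ℝ := fun w => b (e.symm w) with hF
  have hFs : ContDiffOn ℝ ∞ F D := fun w hw =>
    (ContDiffAt.comp w (hb.contDiffAt (hO.mem_nhds (hball w hw).2.1))
      (hsymm_smooth w hw)).contDiffWithinAt
  have hF' : ∀ w ∈ D, HasFDerivAt F (g (e.symm w) • l) w := by
    intro w hw
    have h1 : HasFDerivAt e.symm (fderiv ℝ e.symm w) w :=
      ((hsymm_smooth w hw).differentiableAt (by simp)).hasFDerivAt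
    have h2 := (differentiableAt_of_contDiffOn hO hb (hball w hw).2.1).hasFDerivAt.comp w h1
    have h3 := (differentiableAt_of_contDiffOn hO hφ (hball w hw).2.1).hasFDerivAt.comp w h1
    have h4 : HasFDerivAt (φ ∘ e.symm) l w :=
      (l.hasFDerivAt.add_const (φ y₀ - l y₀)).congr_of_eventuallyEq
        (Filter.mem_of_superset (hDo.mem_nhds hw) hφe)
    refine h2.congr_fderiv ?_
    ext u
    have h5 := congrArg (fun L : E →L[ℝ] ℝ => L u) (h3.unique h4)
    simp only [ContinuousLinearMap.comp_apply] at h5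
    simp [hdb _ (hball w hw).2.1, h5]
  -- F' is a multiple of l, so by the mean value theorem on the convex ball F is constant on level
  -- sets of l.
  have hFc : ∀ w ∈ D, ∀ w' ∈ D, l w = l w' → F w = F w' := by
    intro w hw w' hw' hww
    obtain ⟨x, -, hx⟩ := domain_mvt (fun x hx => (hF' x hx).hasFDerivWithinAt)
      (convex_ball y₀ r) hw hw'
    have : l (w' - w) = 0 := by simp [hww]
    simp only [smul_apply, this] at hx
    rw [smul_zero] at hx
    linarith
  have hcurve : Continuous fun s : ℝ => y₀ + (s - φ y₀) • v := by fun_prop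
  have hproj : Continuous fun w : E => y₀ + l (w - y₀) • v := by fun_prop
  -- The function sought is F along the line y₀ + ℝv. The neighbourhood keeps both T y and its
  -- projection to that line along ker l inside the ball.
  refine ⟨e.source ∩ e ⁻¹' (D ∩ (fun w : E => y₀ + l (w - y₀) • v) ⁻¹' D),
    e.isOpen_inter_preimage (hDo.inter (hDo.preimage hproj)), ⟨hsrc, ?_, ?_⟩, ?_,
    (fun s : ℝ => y₀ + (s - φ y₀) • v) ⁻¹' D, fun s => F (y₀ + (s - φ y₀) • v),
    hDo.preimage hcurve, ?_, ?_, ?_, ?_⟩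
  · rw [hee, hT₀]; exact Metric.mem_ball_self hr
  · simp [hee, hT₀, hD, hr]
  · rintro y ⟨hy1, hy2, -⟩
    have := (hball _ hy2).2.1
    rwa [e.left_inv hy1] at this
  · exact hFs.comp (by fun_prop) fun s hs => hs
  · exact fun s hs => ⟨_, (hball _ hs).2.1, rfl⟩
  · rintro y ⟨hy1, hy2, hy3⟩
    have h1 : φ y - φ y₀ = l (e y - y₀) := by
      rw [map_sub, hee, hlT]; ring
    simpa [h1] using hy3
  · rintro y ⟨hy1, hy2, hy3⟩
    have h1 : φ y - φ y₀ = l (e y - y₀) := by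
      rw [map_sub, hee, hlT]; ring
    have h2 : F (e y) = b y := by simp only [hF, e.left_inv hy1]
    rw [← h2]
    simp only [h1]
    refine hFc _ hy2 _ hy3 ?_
    simp [hv]

end FunctionalDependence

/-! ### A linearization solves the five systems. -/

theorem contact_factor_ne_zero {U : Set Jet1} {φ ψ χ lam : Jet1 → ℝ} (hU : IsOpen U)
    (h : IsContactTransformation U φ ψ χ lam) {y : Jet1} (hy : y ∈ U) : lam y ≠ 0 := by
  -- With a vanishing factor, dψ = χ dφ, so (0, 1, 0) would not lie in the range of the invertible
  -- differential.
  intro h0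
  apply h.jacobian y hy
  have h1 := (differentiableAt_of_contDiffOn hU h.smooth_φ hy).hasFDerivAt.prodMk
    ((differentiableAt_of_contDiffOn hU h.smooth_ψ hy).hasFDerivAt.prodMk
      (differentiableAt_of_contDiffOn hU h.smooth_χ hy).hasFDerivAt)
  rw [h1.fderiv]
  by_contra hdet
  have hker := LinearMap.det_eq_zero_iff_ker_ne_bot.not.1 hdet
  rw [not_not] at hker
  have hsurj := LinearMap.injective_iff_surjective.1 (LinearMap.ker_eq_bot.1 hker)
  obtain ⟨v, hv⟩ := hsurj (0, 1, 0)
  have e1 : fderiv ℝ φ y v = 0 := congrArg Prod.fst hv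
  have e2 : fderiv ℝ ψ y v = 1 := congrArg (fun w : Jet1 => w.2.1) hv
  have := h.contact y hy v
  rw [e1, e2, h0] at this
  norm_num at this

theorem contact_factor_smooth {U : Set Jet1} {φ ψ χ lam : Jet1 → ℝ} (hU : IsOpen U)
    (h : IsContactTransformation U φ ψ χ lam) : ContDiffOn ℝ ∞ lam U := by
  refine ((contDiffOn_fderiv_apply hU h.smooth_ψ
    (contDiffOn_const (c := ((0, 1, 0) : Jet1)))).sub
    (h.smooth_χ.mul (contDiffOn_fderiv_apply hU h.smooth_φ
      (contDiffOn_const (c := ((0, 1, 0) : Jet1)))))).congr fun y hy => ?_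
  have := h.contact y hy (0, 1, 0)
  simp only at this
  change lam y = fderiv ℝ ψ y _ - χ y * fderiv ℝ φ y _
  linear_combination -this

theorem fderiv_lift_comp {Ω : Set Jet2} (hΩ : IsOpen Ω) {φ : Jet1 → ℝ} {S : Set ℝ} {a : ℝ → ℝ}
    (hφ : ContDiffOn ℝ ∞ φ (proj '' Ω)) (hS : IsOpen S) (ha : ContDiffOn ℝ ∞ a S)
    (hm : Set.MapsTo φ (proj '' Ω) S) {z : Jet2} (hz : z ∈ Ω) (v : Jet2) :
    fderiv ℝ (lift fun y => a (φ y)) z v =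
      deriv a (φ (proj z)) * fderiv ℝ (lift φ) z v := by
  have h1 : HasDerivAt a (deriv a (lift φ z)) (lift φ z) :=
    (differentiableAt_of_contDiffOn hS ha (hm ⟨z, hz, rfl⟩)).hasDerivAt
  have h2 := (differentiableAt_of_contDiffOn hΩ (contDiffOn_lift hφ) hz).hasFDerivAt
  have h3 : HasFDerivAt (lift fun y => a (φ y)) _ z := h1.comp_hasFDerivAt z h2
  rw [h3.fderiv]
  rfl

theorem LinearizesTo.linearizingData {f : Jet2 → ℝ} {Ω : Set Jet2} (hΩ : IsOpen Ω)
    (hf : ContDiffOn ℝ ∞ f Ω) {S : Set ℝ} {abar : ℝ → ℝ} {φ ψ χ lam : Jet1 → ℝ}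
    (h : LinearizesTo f Ω S abar φ ψ χ lam) :
    LinearizingData f Ω (lift φ) (lift ψ) (lift χ) (lift lam) (prolong f φ χ)
      (lift fun y => abar (φ y)) (lift fun y => deriv abar (φ y) / abar (φ y) ^ 2)
      (lift fun y => deriv (fun s => deriv abar s / abar s ^ 2) (φ y)) := by
  have hO := isOpen_proj_image hΩ
  have hS := h.coefficient.isOpen
  have ha := h.coefficient.smooth
  have ha' : ContDiffOn ℝ ∞ (deriv abar) S := ha.deriv_of_isOpen hS (by simp)
  have hh : ContDiffOn ℝ ∞ (fun s => deriv abar s / abar s ^ 2) S :=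
    ha'.div (ha.pow 2) fun s hs => pow_ne_zero _ (h.coefficient.ne_zero s hs)
  have hh' : ContDiffOn ℝ ∞ (deriv fun s => deriv abar s / abar s ^ 2) S :=
    hh.deriv_of_isOpen hS (by simp)
  have hc := h.contact
  have hφ := hc.smooth_φ
  have hψ := hc.smooth_ψ
  have hχ := hc.smooth_χ
  have hlam := contact_factor_smooth hO hc
  have hη : ContDiffOn ℝ ∞ (prolong f φ χ) Ω :=
    (contDiffOn_Dhat hΩ hf (contDiffOn_lift hχ)).div
      (contDiffOn_Dhat hΩ hf (contDiffOn_lift hφ)) h.transforms.regular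
  have hq : ∀ {F : Jet1 → ℝ}, ContDiffOn ℝ ∞ F (proj '' Ω) → ∀ z ∈ Ω, pdq (lift F) z = 0 :=
    fun hF z hz => pdq_lift (differentiableAt_of_contDiffOn hO hF ⟨z, hz, rfl⟩)
  have hcv : ∀ z ∈ Ω, ∀ v : Jet2, fderiv ℝ (lift ψ) z v - lift χ z * fderiv ℝ (lift φ) z v =
      lift lam z * (v.2.1 - z.2.2.1 * v.1) := by
    intro z hz v
    rw [fderiv_lift (differentiableAt_of_contDiffOn hO hψ ⟨z, hz, rfl⟩),
      fderiv_lift (differentiableAt_of_contDiffOn hO hφ ⟨z, hz, rfl⟩)]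
    exact hc.contact (proj z) ⟨z, hz, rfl⟩ (proj v)
  exact {
    isOpen := hΩ
    smooth_f := hf
    smooth_Φ := contDiffOn_lift hφ
    smooth_Ψ := contDiffOn_lift hψ
    smooth_Χ := contDiffOn_lift hχ
    smooth_Λ := contDiffOn_lift hlam
    smooth_η := hη
    smooth_B := contDiffOn_lift (ha.comp hφ h.mapsTo)
    smooth_H := contDiffOn_lift (hh.comp hφ h.mapsTo)
    smooth_G := contDiffOn_lift (hh'.comp hφ h.mapsTo)
    Φ_q := hq hφ
    Ψ_q := hq hψ
    Χ_q := hq hχ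
    Λ_q := hq hlam
    G_q := hq (hh'.comp hφ h.mapsTo)
    Φ_ne := h.transforms.regular
    Λ_ne := fun z hz => contact_factor_ne_zero hO hc ⟨z, hz, rfl⟩
    B_ne := fun z hz => h.coefficient.ne_zero _ (h.mapsTo ⟨z, hz, rfl⟩)
    dB := by
      intro z hz v
      rw [fderiv_lift_comp hΩ hφ hS ha h.mapsTo hz]
      have : abar (φ (proj z)) ≠ 0 := h.coefficient.ne_zero _ (h.mapsTo ⟨z, hz, rfl⟩)
      simp only [lift]
      field_simp
    dH := fun z hz v => fderiv_lift_comp hΩ hφ hS hh h.mapsTo hz v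
    Ψ_D := by
      intro z hz
      -- The form `du - p dx` annihilates D̂ₓ.
      have := hcv z hz (hatField f z)
      simp only [← Dhat_eq] at this
      simp only [hatField] at this
      linear_combination this
    Χ_D := by
      intro z hz
      have := h.transforms.regular z hz
      simp only [prolong]
      field_simp
    η_D := by
      intro z hz
      have h1 := h.transforms.equation z hz
      rw [div_eq_iff (h.transforms.regular z hz)] at h1
      exact h1
    Ψ_p := by
      intro z hz
      have := hcv z hz (0, 0, 1, 0)
      change coeffP (lift ψ) (lift χ) (lift φ) z = _ at this
      rw [this]; simp
    Ψ_u := by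
      intro z hz
      have := hcv z hz (0, 1, 0, 0)
      change coeffU (lift ψ) (lift χ) (lift φ) z = _ at this
      rw [this]; simp }

theorem LinearizesTo.solvesSystems {f : Jet2 → ℝ} {Ω : Set Jet2} (hΩ : IsOpen Ω)
    (hf : ContDiffOn ℝ ∞ f Ω) {S : Set ℝ} {abar : ℝ → ℝ} {φ ψ χ lam : Jet1 → ℝ}
    (h : LinearizesTo f Ω S abar φ ψ χ lam) :
    SolvesSystems f Ω (fun y => deriv abar (φ y) / abar (φ y) ^ 2) (fun y => abar (φ y))
      lam φ (prolong f φ χ) χ ψ := by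
  have d := h.linearizingData hΩ hf
  have hS := h.coefficient.isOpen
  have ha := h.coefficient.smooth
  have ha' : ContDiffOn ℝ ∞ (deriv abar) S := ha.deriv_of_isOpen hS (by simp)
  have hc := h.contact
  have hb : ContDiffOn ℝ ∞ (fun y => abar (φ y)) (proj '' Ω) := ha.comp hc.smooth_φ h.mapsTo
  have hβ : ∀ z ∈ Ω, coeffP (lift χ) (prolong f φ χ) (lift φ) z =
      -(lift (fun y => abar (φ y)) z * lift lam z / J3 f z) := by
    intro z hz
    have hR := d.Φ_ne z hz
    have hB := d.B_ne z hz
    rw [d.J3_eq hz, d.Λ_eq hz]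
    field_simp
  have hg : ∀ z ∈ Ω, pdq (prolong f φ χ) z =
      lift (fun y => abar (φ y)) z ^ 2 * lift lam z / J3 f z ^ 2 := by
    intro z hz
    have hR := d.Φ_ne z hz
    have hB := d.B_ne z hz
    rw [d.J3_eq hz, d.Λ_eq_g hz]
    field_simp
  refine ⟨((ha'.comp hc.smooth_φ h.mapsTo).div (hb.pow 2) ?_), hb,
    contact_factor_smooth (isOpen_proj_image hΩ) hc, hc.smooth_φ, d.smooth_η, hc.smooth_χ,
    hc.smooth_ψ, ?_, ?_, fun z hz => d.K_eq hz, fun z hz => d.B_D hz, fun z hz => d.Λ_D hz,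
    fun z hz => d.Λ_u hz, fun z hz => d.Λ_p hz, d.Λ_q, fun z hz => d.Φ_D hz,
    fun z hz => d.Φ_u hz, fun z hz => d.Φ_p hz, ?_, ?_, ?_, hg, ?_, ?_, ?_, ?_, ?_, ?_, ?_, ?_⟩
  · exact fun y hy => pow_ne_zero _ (h.coefficient.ne_zero _ (h.mapsTo hy))
  · exact fun y hy => h.coefficient.ne_zero _ (h.mapsTo hy)
  · exact fun y hy => contact_factor_ne_zero (isOpen_proj_image hΩ) hc hy
  · intro z hz
    rw [d.η_D z hz, d.Φ_D hz]; ring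
  · intro z hz
    have h1 := d.coeffU_η_eq hz
    rw [coeffU, ← d.J3_mul_I5 hz, d.Φ_u hz, hg z hz] at h1
    have hJ := d.J3_ne hz
    rw [sub_eq_iff_eq_add] at h1
    rw [h1]
    field_simp
    ring
  · intro z hz
    have h1 := d.coeffP_η_eq hz
    rw [coeffP, ← d.J3_mul_I5 hz, d.Φ_p hz, hg z hz] at h1
    have hJ := d.J3_ne hz
    rw [sub_eq_iff_eq_add] at h1
    rw [h1]
    field_simp
    ring
  · intro z hz
    rw [d.Χ_D z hz, d.Φ_D hz]; ring
  · intro z hz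
    have h1 := d.coeffU_Χ_eq_I5 hz
    rw [coeffU, d.Φ_u hz] at h1
    linear_combination h1
  · intro z hz
    have h1 := hβ z hz
    rw [coeffP, d.Φ_p hz] at h1
    linear_combination h1
  · intro z hz
    have h1 := d.Ψ_u z hz
    rw [coeffU] at h1
    rw [d.Ψ_D z hz, d.I7_eq hz, d.J3_eq hz]
    linear_combination Dhat f (lift φ) z * lift (fun y => abar (φ y)) z * h1
  · intro z hz
    have h1 := d.Ψ_D z hz
    have h2 := d.Ψ_u z hz
    have h3 := d.Ψ_p z hz
    rw [coeffU] at h2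
    rw [coeffP] at h3
    simp only [Dhat, d.Ψ_q z hz, d.Φ_q z hz] at h1
    linear_combination h1 - z.2.2.1 * h2 - z.2.2.2 * h3
  · intro z hz
    have h3 := d.Ψ_p z hz
    rw [coeffP, d.Φ_p hz] at h3
    linear_combination h3
  · intro z hz
    rw [d.Ψ_D z hz, mul_div_cancel_right₀ _ (d.Φ_ne z hz)]
  · exact fun z hz => rfl

/-- η ≡ 0 would contradict η_q ≠ 0. Since D̂ₓχ = ηR, D̂ₓψ = χR and R ≠ 0, χ ≡ 0 would force η ≡ 0,
and ψ ≡ 0 would force χ ≡ 0. -/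
theorem LinearizingData.exists_ne_zero {f : Jet2 → ℝ} {Ω : Set Jet2}
    {φ ψ χ : Jet1 → ℝ} {Λ η B H G : Jet2 → ℝ}
    (d : LinearizingData f Ω (lift φ) (lift ψ) (lift χ) Λ η B H G) (hne : Ω.Nonempty) :
    (∃ y ∈ proj '' Ω, φ y ≠ 0) ∧ (∃ z ∈ Ω, η z ≠ 0) ∧
      (∃ y ∈ proj '' Ω, χ y ≠ 0) ∧ (∃ y ∈ proj '' Ω, ψ y ≠ 0) := by
  obtain ⟨z, hz⟩ := hne
  have hη : ∃ z ∈ Ω, η z ≠ 0 := by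
    by_contra! h0
    exact d.g_ne hz (fderiv_eq_zero_of_isOpen d.isOpen h0 hz _)
  have hχ : ∃ z ∈ Ω, lift χ z ≠ 0 := by
    by_contra! h0
    obtain ⟨w, hw, hηw⟩ := hη
    have := d.Χ_D w hw
    rw [Dhat_eq_zero d.isOpen h0 hw] at this
    exact mul_ne_zero hηw (d.Φ_ne w hw) this.symm
  have hψ : ∃ z ∈ Ω, lift ψ z ≠ 0 := by
    by_contra! h0
    obtain ⟨w, hw, hχw⟩ := hχ
    have := d.Ψ_D w hw
    rw [Dhat_eq_zero d.isOpen h0 hw] at this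
    exact mul_ne_zero hχw (d.Φ_ne w hw) this.symm
  have hφ : ∃ z ∈ Ω, lift φ z ≠ 0 := by
    by_contra! h0
    exact d.Φ_ne z hz (Dhat_eq_zero d.isOpen h0 hz)
  refine ⟨?_, hη, ?_, ?_⟩
  · obtain ⟨w, hw, h⟩ := hφ
    exact ⟨_, ⟨w, hw, rfl⟩, h⟩
  · obtain ⟨w, hw, h⟩ := hχ
    exact ⟨_, ⟨w, hw, rfl⟩, h⟩
  · obtain ⟨w, hw, h⟩ := hψ
    exact ⟨_, ⟨w, hw, rfl⟩, h⟩

/-! ### Solutions of the systems give linearizations. -/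

/-- `A_p = g φ_p` when `D̂ₓA = g D̂ₓφ` and `A`, `g`, `φ` do not depend on `q`. -/
theorem coeffP_eq_zero {f A g Φ : Jet2 → ℝ} {V : Set Jet2} (hV : IsOpen V)
    (hf : ContDiffOn ℝ ∞ f V) (hA : ContDiffOn ℝ ∞ A V) (hg : ContDiffOn ℝ ∞ g V)
    (hΦ : ContDiffOn ℝ ∞ Φ V) (hAq : ∀ z ∈ V, pdq A z = 0) (hgq : ∀ z ∈ V, pdq g z = 0)
    (hΦq : ∀ z ∈ V, pdq Φ z = 0) (h : ∀ z ∈ V, Dhat f A z = g z * Dhat f Φ z) {z : Jet2}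
    (hz : z ∈ V) : coeffP A g Φ z = 0 := by
  -- For functions free of q, ∂_q D̂ₓ reduces to ∂_p.
  have h1 := pdq_Dhat hV hf hA hz
  have h2 := pdq_Dhat hV hf hΦ hz
  have h3 := fderiv_of_eq_mul hV hg (contDiffOn_Dhat hV hf hΦ) h hz (0, 0, 0, 1)
  change pdq (Dhat f A) z = _ * pdq (Dhat f Φ) z + _ * pdq g z at h3
  rw [Dhat_eq_zero hV hAq hz, hAq z hz] at h1
  rw [Dhat_eq_zero hV hΦq hz, hΦq z hz] at h2
  rw [h1, h2, hgq z hz] at h3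
  rw [coeffP]
  linear_combination h3

namespace SolvesSystems

variable {f : Jet2 → ℝ} {V : Set Jet2} {H b a₁ φ : Jet1 → ℝ} {η : Jet2 → ℝ} {χ ψ : Jet1 → ℝ}

theorem mono (s : SolvesSystems f V H b a₁ φ η χ ψ) {W : Set Jet2} (hW : W ⊆ V) :
    SolvesSystems f W H b a₁ φ η χ ψ := by
  have hp : proj '' W ⊆ proj '' V := Set.image_mono hW
  obtain ⟨s1, s2, s3, s4, s5, s6, s7, s8, s9, e1, e2, e3, e4, e5, e6, e7, e8, e9, e10, e11, e12,
    e13, e14, e15, e16, e17, e18, e19, e20, e21⟩ := s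
  exact ⟨s1.mono hp, s2.mono hp, s3.mono hp, s4.mono hp, s5.mono hW, s6.mono hp, s7.mono hp,
    fun y hy => s8 y (hp hy), fun y hy => s9 y (hp hy), fun z hz => e1 z (hW hz),
    fun z hz => e2 z (hW hz), fun z hz => e3 z (hW hz), fun z hz => e4 z (hW hz),
    fun z hz => e5 z (hW hz), fun z hz => e6 z (hW hz), fun z hz => e7 z (hW hz),
    fun z hz => e8 z (hW hz), fun z hz => e9 z (hW hz), fun z hz => e10 z (hW hz),
    fun z hz => e11 z (hW hz), fun z hz => e12 z (hW hz), fun z hz => e13 z (hW hz),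
    fun z hz => e14 z (hW hz), fun z hz => e15 z (hW hz), fun z hz => e16 z (hW hz),
    fun z hz => e17 z (hW hz), fun z hz => e18 z (hW hz), fun z hz => e19 z (hW hz),
    fun z hz => e20 z (hW hz), fun z hz => e21 z (hW hz)⟩

theorem b_ne (s : SolvesSystems f V H b a₁ φ η χ ψ) {z : Jet2} (hz : z ∈ V) : lift b z ≠ 0 :=
  s.b_ne_zero _ ⟨z, hz, rfl⟩

theorem a₁_ne (s : SolvesSystems f V H b a₁ φ η χ ψ) {z : Jet2} (hz : z ∈ V) : lift a₁ z ≠ 0 :=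
  s.a₁_ne_zero _ ⟨z, hz, rfl⟩

theorem Dhat_φ_ne (s : SolvesSystems f V H b a₁ φ η χ ψ) (hJ : ∀ z ∈ V, J3 f z ≠ 0) {z : Jet2}
    (hz : z ∈ V) : Dhat f (lift φ) z ≠ 0 := by
  rw [s.φ_x z hz]
  exact neg_ne_zero.2 (div_ne_zero (hJ z hz) (s.b_ne hz))

theorem contact_form (s : SolvesSystems f V H b a₁ φ η χ ψ) (hV : IsOpen V)
    (hJ : ∀ z ∈ V, J3 f z ≠ 0) {z : Jet2} (hz : z ∈ V) (v : Jet1) :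
    fderiv ℝ ψ (proj z) v - χ (proj z) * fderiv ℝ φ (proj z) v =
      a₁ (proj z) * (v.2.1 - (proj z).2.2 * v.1) := by
  have hO := isOpen_proj_image hV
  have hy : proj z ∈ proj '' V := ⟨z, hz, rfl⟩
  have e1 := fderiv_lift (differentiableAt_of_contDiffOn hO s.smooth_ψ hy)
    (v.1, v.2.1, v.2.2, 0)
  have e2 := fderiv_lift (differentiableAt_of_contDiffOn hO s.smooth_φ hy)
    (v.1, v.2.1, v.2.2, 0)
  rw [fderiv_apply_eq] at e1 e2
  change _ = fderiv ℝ ψ (proj z) v at e1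
  change _ = fderiv ℝ φ (proj z) v at e2
  -- Substituting D̂ₓψ = χ D̂ₓφ = -χJ₃/b into `ψ_D` makes J₃ a common factor.
  have hu : pdu (lift ψ) z - lift χ z * pdu (lift φ) z = lift a₁ z := by
    have h1 := s.ψ_D z hz
    have h2 := s.χ_eq z hz
    rw [eq_div_iff (s.Dhat_φ_ne hJ hz), s.φ_x z hz] at h2
    rw [← h2] at h1
    rw [s.φ_u z hz]
    apply mul_left_cancel₀ (hJ z hz)
    linear_combination -h1
  rw [← e1, ← e2, s.ψ_x z hz, s.ψ_p z hz, s.φ_p z hz]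
  simp only [lift, proj] at hu ⊢
  linear_combination v.2.1 * hu

/-- A kernel vector annihilates dψ - χ dφ, hence du - p dx. On such vectors dχ - η dφ is -(b
a₁/J₃)(dp - q dx), so dp - q dx vanishes too, and then dφ = D̂ₓφ dx forces the vector to be zero. -/
theorem jacobian_ne_zero (s : SolvesSystems f V H b a₁ φ η χ ψ) (hV : IsOpen V)
    (hJ : ∀ z ∈ V, J3 f z ≠ 0) {z : Jet2} (hz : z ∈ V) :
    (fderiv ℝ (fun w : Jet1 => (φ w, ψ w, χ w)) (proj z)).det ≠ 0 := by
  have hO := isOpen_proj_image hV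
  have hy : proj z ∈ proj '' V := ⟨z, hz, rfl⟩
  have dφ := differentiableAt_of_contDiffOn hO s.smooth_φ hy
  have dψ := differentiableAt_of_contDiffOn hO s.smooth_ψ hy
  have dχ := differentiableAt_of_contDiffOn hO s.smooth_χ hy
  rw [(dφ.hasFDerivAt.prodMk (dψ.hasFDerivAt.prodMk dχ.hasFDerivAt)).fderiv]
  intro hdet
  refine LinearMap.det_eq_zero_iff_ker_ne_bot.1 hdet (LinearMap.ker_eq_bot'.2 fun v hv => ?_)
  have v1 : fderiv ℝ φ (proj z) v = 0 := congrArg Prod.fst hv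
  have v2 : fderiv ℝ ψ (proj z) v = 0 := congrArg (fun w : Jet1 => w.2.1) hv
  have v3 : fderiv ℝ χ (proj z) v = 0 := congrArg (fun w : Jet1 => w.2.2) hv
  have h1 := s.contact_form hV hJ hz v
  rw [v1, v2] at h1
  have h2 : v.2.1 = z.2.2.1 * v.1 := by
    have h3 : a₁ (proj z) * (v.2.1 - (proj z).2.2 * v.1) = 0 := by linear_combination -h1
    have h4 := (mul_eq_zero.1 h3).resolve_left (s.a₁_ne hz)
    simp only [proj] at h4
    linear_combination h4
  have e1 := fderiv_lift dφ (v.1, v.2.1, v.2.2, 0)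
  have e3 := fderiv_lift dχ (v.1, v.2.1, v.2.2, 0)
  rw [fderiv_apply_eq] at e1 e3
  change _ = fderiv ℝ φ (proj z) v at e1
  change _ = fderiv ℝ χ (proj z) v at e3
  rw [v1] at e1
  rw [v3] at e3
  have f1 := s.φ_x z hz
  have f3 := s.χ_x z hz
  simp only [Dhat, pdq_lift dφ, pdq_lift dχ] at f1 f3
  rw [s.φ_u z hz, s.φ_p z hz] at f1 e1
  rw [s.χ_u z hz, s.χ_p z hz] at f3 e3
  simp only [h2] at e1 e3
  have hb := s.b_ne hz
  have ha := s.a₁_ne hz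
  have hJz := hJ z hz
  have h5 : lift b z * lift a₁ z / J3 f z * (v.2.2 - z.2.2.2 * v.1) = 0 := by
    linear_combination -e3 + v.1 * f3 + η z * e1 - η z * v.1 * f1
  have h6 : v.2.2 = z.2.2.2 * v.1 := by
    have := (mul_eq_zero.1 h5).resolve_left (div_ne_zero (mul_ne_zero hb ha) hJz)
    linear_combination this
  have h7 : J3 f z / lift b z * v.1 = 0 := by
    simp only [h6] at e1
    linear_combination v.1 * f1 - e1
  have h8 : v.1 = 0 := (mul_eq_zero.1 h7).resolve_left (div_ne_zero hJz hb)
  rw [h8, mul_zero] at h2 h6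
  exact Prod.ext h8 (Prod.ext h2 h6)

theorem linearizesTo (s : SolvesSystems f V H b a₁ φ η χ ψ) (hV : IsOpen V)
    (hJ : ∀ z ∈ V, J3 f z ≠ 0) {S : Set ℝ} {abar : ℝ → ℝ} (hS : IsCoefficient S abar)
    (hm : Set.MapsTo φ (proj '' V) S) (hb : ∀ y ∈ proj '' V, b y = abar (φ y)) :
    LinearizesTo f V S abar φ ψ χ a₁ := by
  refine ⟨hS, hm, ⟨s.smooth_φ, s.smooth_ψ, s.smooth_χ, ?_, ?_⟩,
    ⟨fun z hz => s.Dhat_φ_ne hJ hz, ?_⟩⟩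
  · rintro _ ⟨z, hz, rfl⟩ v
    exact s.contact_form hV hJ hz v
  · rintro _ ⟨z, hz, rfl⟩
    exact s.jacobian_ne_zero hV hJ hz
  · intro z hz
    rw [Dhat_congr (F := prolong f φ χ) (G := η) hV (fun w hw => (s.η_eq w hw).symm) hz,
      div_eq_iff (s.Dhat_φ_ne hJ hz), s.η_x z hz, s.φ_x z hz]
    change _ = abar (φ (proj z)) ^ 3 * ψ (proj z) * _
    rw [← hb _ ⟨z, hz, rfl⟩]
    simp only [lift]
    ring

/-- The identity is known along D̂ₓ from systems 2 and 4. The directions ∂_p and ∂_u follow by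
applying ∂_q and then D̂ₓ; the latter needs H_p to be proportional to φ_p, which is where K_q = 0
enters. -/
theorem fderiv_b (s : SolvesSystems f V H b a₁ φ η χ ψ) (hV : IsOpen V)
    (hf : ContDiffOn ℝ ∞ f V) (hJ : ∀ z ∈ V, J3 f z ≠ 0) (hK : ContDiffOn ℝ ∞ (K f) V)
    (hKq : ∀ z ∈ V, pdq (K f) z = 0) {y : Jet1} (hy : y ∈ proj '' V) (v : Jet1) :
    fderiv ℝ b y v = H y * b y ^ 2 * fderiv ℝ φ y v := by
  have hO := isOpen_proj_image hV
  have hq : ∀ {F : Jet1 → ℝ}, ContDiffOn ℝ ∞ F (proj '' V) → ∀ z ∈ V, pdq (lift F) z = 0 :=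
    fun hF z hz => pdq_lift (differentiableAt_of_contDiffOn hO hF ⟨z, hz, rfl⟩)
  have sH := contDiffOn_lift s.smooth_H
  have sb := contDiffOn_lift s.smooth_b
  have sφ := contDiffOn_lift s.smooth_φ
  have sg0 : ContDiffOn ℝ ∞ (fun y => H y * b y ^ 2) (proj '' V) :=
    s.smooth_H.mul (s.smooth_b.pow 2)
  have sg := contDiffOn_lift sg0
  have hbD : ∀ z ∈ V, Dhat f (lift b) z =
      lift (fun y => H y * b y ^ 2) z * Dhat f (lift φ) z := by
    intro z hz
    have := s.b_ne hz
    rw [s.b_eq z hz, s.φ_x z hz]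
    change _ = lift H z * lift b z ^ 2 * _
    field_simp
  -- System 1 solved for D̂ₓH, with J₃ replaced by -b D̂ₓφ.
  have hHD : ∀ z ∈ V, Dhat f (lift H) z =
      (lift (fun y => 1 / 2 * b y) z * (K f z - lift H z * lift H z)) * Dhat f (lift φ) z := by
    intro z hz
    have h1 := s.b_ne hz
    have h2 := hJ z hz
    have h3 := s.H_eq z hz
    rw [← h3, s.φ_x z hz]
    change _ = 1 / 2 * lift b z * _ * _
    field_simp
    ring
  have sb2 : ContDiffOn ℝ ∞ (fun y => 1 / 2 * b y) (proj '' V) :=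
    contDiffOn_const.mul s.smooth_b
  have sKH : ContDiffOn ℝ ∞ (fun z => K f z - lift H z * lift H z) V := hK.sub (sH.mul sH)
  have sG := (contDiffOn_lift sb2).mul sKH
  have hGq : ∀ z ∈ V, pdq (fun z => lift (fun y => 1 / 2 * b y) z *
      (K f z - lift H z * lift H z)) z = 0 := by
    intro z hz
    have h1 := fderiv_of_eq_mul hV (contDiffOn_lift sb2) sKH (fun w _ => rfl) hz (0, 0, 0, 1)
    have h2 := fderiv_sub_mul (differentiableAt_of_contDiffOn hV hK hz)
      (differentiableAt_of_contDiffOn hV sH hz) (differentiableAt_of_contDiffOn hV sH hz)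
      (0, 0, 0, 1)
    rw [h2] at h1
    change _ = _ * (pdq (K f) z - (_ * pdq (lift H) z + _ * pdq (lift H) z)) +
      _ * pdq (lift fun y => 1 / 2 * b y) z at h1
    rw [hKq z hz, hq s.smooth_H z hz, hq sb2 z hz] at h1
    rw [pdq, h1]; ring
  have hbp : ∀ z ∈ V, coeffP (lift b) (lift fun y => H y * b y ^ 2) (lift φ) z = 0 :=
    fun z hz => coeffP_eq_zero hV hf sb sg sφ (hq s.smooth_b) (hq sg0) (hq s.smooth_φ) hbD hz
  have hHp : ∀ z ∈ V, coeffP (lift H) (fun z => lift (fun y => 1 / 2 * b y) z *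
      (K f z - lift H z * lift H z)) (lift φ) z = 0 :=
    fun z hz => coeffP_eq_zero hV hf sH sG sφ (hq s.smooth_H) hGq (hq s.smooth_φ) hHD hz
  have hdg : ∀ z ∈ V, ∀ w, fderiv ℝ (lift fun y => H y * b y ^ 2) z w =
      lift b z ^ 2 * fderiv ℝ (lift H) z w +
        2 * lift H z * lift b z * fderiv ℝ (lift b) z w := by
    intro z hz w
    rw [fderiv_of_eq_mul (A := lift fun y => H y * b y ^ 2) hV sH (sb.mul sb)
        (fun u _ => by simp [lift, pow_two]) hz,
      fderiv_of_eq_mul hV sb sb (fun u _ => rfl) hz]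
    change _ + lift b z * lift b z * _ = _
    ring
  have hgD : ∀ z ∈ V, Dhat f (lift fun y => H y * b y ^ 2) z =
      (lift b z ^ 2 * (lift (fun y => 1 / 2 * b y) z * (K f z - lift H z * lift H z)) +
        2 * lift H z * lift b z * lift (fun y => H y * b y ^ 2) z) * Dhat f (lift φ) z := by
    intro z hz
    rw [Dhat_eq, hdg z hz, ← Dhat_eq, ← Dhat_eq, hbD z hz, hHD z hz]
    ring
  obtain ⟨z, hz, rfl⟩ := hy
  -- The p-coefficient vanishes on V, so its structure equation isolates the u-coefficient.
  have hbu : coeffU (lift b) (lift fun y => H y * b y ^ 2) (lift φ) z = 0 := by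
    have h1 := Dhat_coeffP hV hf sb sg sφ hbD hgD hz
    have h2 : coeffP (lift fun y => H y * b y ^ 2) (fun z =>
        lift b z ^ 2 * (lift (fun y => 1 / 2 * b y) z * (K f z - lift H z * lift H z)) +
        2 * lift H z * lift b z * lift (fun y => H y * b y ^ 2) z) (lift φ) z = 0 := by
      have h3 := hdg z hz (0, 0, 1, 0)
      change pdp _ z = _ * pdp (lift H) z + _ * pdp (lift b) z at h3
      have h4 := hbp z hz
      have h5 := hHp z hz
      rw [coeffP] at h4 h5 ⊢
      rw [h3]
      linear_combination lift b z ^ 2 * h5 + 2 * lift H z * lift b z * h4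
    have h6 : coeffQ (lift b) (lift fun y => H y * b y ^ 2) (lift φ) z = 0 := by
      rw [coeffQ, hq s.smooth_b z hz, hq s.smooth_φ z hz]; ring
    rw [Dhat_eq_zero hV hbp hz, h2, h6] at h1
    linear_combination h1
  have e1 := fderiv_lift (differentiableAt_of_contDiffOn hO s.smooth_b ⟨z, hz, rfl⟩)
    (v.1, v.2.1, v.2.2, 0)
  have e2 := fderiv_lift (differentiableAt_of_contDiffOn hO s.smooth_φ ⟨z, hz, rfl⟩)
    (v.1, v.2.1, v.2.2, 0)
  rw [fderiv_apply_eq] at e1 e2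
  change _ = fderiv ℝ b (proj z) v at e1
  change _ = fderiv ℝ φ (proj z) v at e2
  have h1 := hbD z hz
  have h2 := hbp z hz
  simp only [Dhat, hq s.smooth_b z hz, hq s.smooth_φ z hz] at h1
  rw [coeffP] at h2
  rw [coeffU] at hbu
  rw [← e1, ← e2, hq s.smooth_b z hz, hq s.smooth_φ z hz]
  change _ = lift (fun y => H y * b y ^ 2) z * _
  -- Up to a multiple of ∂_q, the lifted v is v₁D̂ₓ + (v₂ - pv₁)∂_u + (v₃ - qv₁)∂_p.
  linear_combination v.1 * h1 + (v.2.1 - v.1 * z.2.2.1) * hbu + (v.2.2 - v.1 * z.2.2.2) * h2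

theorem exists_coefficient (s : SolvesSystems f V H b a₁ φ η χ ψ) (hV : IsOpen V)
    (hf : ContDiffOn ℝ ∞ f V) (hJ : ∀ z ∈ V, J3 f z ≠ 0) (hK : ContDiffOn ℝ ∞ (K f) V)
    (hKq : ∀ z ∈ V, pdq (K f) z = 0) {z₀ : Jet2} (hz₀ : z₀ ∈ V) :
    ∃ V' : Set Jet2, IsOpen V' ∧ z₀ ∈ V' ∧ V' ⊆ V ∧ ∃ (S : Set ℝ) (abar : ℝ → ℝ),
      LinearizesTo f V' S abar φ ψ χ a₁ ∧ (∀ y ∈ proj '' V', b y = abar (φ y)) ∧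
      (∀ y ∈ proj '' V', H y = deriv abar (φ y) / abar (φ y) ^ 2) := by
  have hO := isOpen_proj_image hV
  have hy₀ : proj z₀ ∈ proj '' V := ⟨z₀, hz₀, rfl⟩
  have hv₀ : fderiv ℝ φ (proj z₀) (proj (hatField f z₀)) ≠ 0 := by
    rw [← fderiv_lift (differentiableAt_of_contDiffOn hO s.smooth_φ hy₀), ← Dhat_eq]
    exact s.Dhat_φ_ne hJ hz₀
  obtain ⟨N, hN, hyN, -, S, a, hS, ha, hab, hm, hba⟩ := exists_comp_of_fderiv_eq_mul hO
    s.smooth_φ s.smooth_b (fun y hy v => s.fderiv_b hV hf hJ hK hKq hy v) hy₀ hv₀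
  have hV' : IsOpen (V ∩ proj ⁻¹' N) := hV.inter (hN.preimage contDiff_proj.continuous)
  have hsub : V ∩ proj ⁻¹' N ⊆ V := Set.inter_subset_left
  have hN' : ∀ y ∈ proj '' (V ∩ proj ⁻¹' N), y ∈ N := by
    rintro _ ⟨z, hz, rfl⟩; exact hz.2
  have hS' : IsCoefficient S a := ⟨hS, ha, fun t ht => by
    obtain ⟨y, hy, h⟩ := hab t ht
    rw [h]; exact s.b_ne_zero y hy⟩
  have s' := s.mono hsub
  have hm' : Set.MapsTo φ (proj '' (V ∩ proj ⁻¹' N)) S := fun y hy => hm (hN' y hy)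
  refine ⟨V ∩ proj ⁻¹' N, hV', ⟨hz₀, hyN⟩, hsub, S, a,
    s'.linearizesTo hV' (fun z hz => hJ z (hsub hz)) hS' hm' (fun y hy => hba y (hN' y hy)),
    fun y hy => hba y (hN' y hy), ?_⟩
  rintro _ ⟨z, hz, rfl⟩
  have hb := s'.b_ne hz
  have hR := s'.Dhat_φ_ne (fun z hz => hJ z (hsub hz)) hz
  have h1 := s'.b_eq z hz
  -- Comparing ā'(φ) D̂ₓφ with D̂ₓb = H b² D̂ₓφ and cancelling D̂ₓφ identifies H.
  have h2 : Dhat f (lift b) z = deriv a (φ (proj z)) * Dhat f (lift φ) z := by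
    rw [Dhat_congr (F := lift b) (G := lift fun y => a (φ y)) hV' (fun w hw => hba _ hw.2) hz, Dhat_eq,
      fderiv_lift_comp hV' s'.smooth_φ hS ha hm' hz, ← Dhat_eq]
  rw [← hba _ hz.2]
  have h3 := s'.φ_x z hz
  rw [eq_div_iff (pow_ne_zero 2 (s'.b_ne_zero _ ⟨z, hz, rfl⟩))]
  change lift H z * lift b z ^ 2 = _
  apply mul_right_cancel₀ hR
  rw [← h2, h1, h3]
  field_simp

end SolvesSystems

end ThirdOrderODE

theorem mainTheorem4
    (f : Jet2 → ℝ) (Ω : Set Jet2) (hΩ : IsOpen Ω) (hf : ContDiffOn ℝ ∞ f Ω)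
    (S : Set ℝ) (abar : ℝ → ℝ) (φ ψ χ a₁ : Jet1 → ℝ)
    (h : LinearizesTo f Ω S abar φ ψ χ a₁) :
    -- the data of the given linearizing transformation solve the five systems
    (∀ z ∈ Ω, I3 f z ≠ 0) ∧
    SolvesSystems f Ω
      (fun y => deriv abar (φ y) / abar (φ y) ^ 2) (fun y => abar (φ y))
      a₁ φ (prolong f φ χ) χ ψ ∧
    (Ω.Nonempty →
      (∃ y ∈ proj '' Ω, φ y ≠ 0) ∧ (∃ z ∈ Ω, prolong f φ χ z ≠ 0) ∧
      (∃ y ∈ proj '' Ω, χ y ≠ 0) ∧ (∃ y ∈ proj '' Ω, ψ y ≠ 0)) ∧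
    -- every solution of the five systems gives a linearizing contact transformation
    (∀ (V : Set Jet2), IsOpen V → V ⊆ Ω →
      ∀ (H b a₁' φ' : Jet1 → ℝ) (η' : Jet2 → ℝ) (χ' ψ' : Jet1 → ℝ),
        SolvesSystems f V H b a₁' φ' η' χ' ψ' →
        -- towards any prescribed coefficient with `b = ā(x̄)`
        (∀ (S' : Set ℝ) (abar' : ℝ → ℝ), IsCoefficient S' abar' →
          Set.MapsTo φ' (proj '' V) S' → (∀ y ∈ proj '' V, b y = abar' (φ' y)) →
          LinearizesTo f V S' abar' φ' ψ' χ' a₁') ∧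
        -- and such a coefficient exists near every point
        (∀ z₀ ∈ V, ∃ V' : Set Jet2, IsOpen V' ∧ z₀ ∈ V' ∧ V' ⊆ V ∧
          ∃ (S' : Set ℝ) (abar' : ℝ → ℝ),
            LinearizesTo f V' S' abar' φ' ψ' χ' a₁' ∧
            (∀ y ∈ proj '' V', b y = abar' (φ' y)) ∧
            (∀ y ∈ proj '' V', H y = deriv abar' (φ' y) / abar' (φ' y) ^ 2))) := by
  have d := h.linearizingData hΩ hf
  refine ⟨fun z hz => d.I3_ne hz, h.solvesSystems hΩ hf, d.exists_ne_zero, ?_⟩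
  intro V hV hVΩ H b a₁' φ' η' χ' ψ' s
  -- J₃ ≠ 0 and K_q = 0 concern f only, so the given transformation provides them for every other
  -- solution.
  have hJ : ∀ z ∈ V, J3 f z ≠ 0 := fun z hz => d.J3_ne (hVΩ hz)
  exact ⟨fun S' abar' hS' hm hb => s.linearizesTo hV hJ hS' hm hb,
    fun z₀ hz₀ => s.exists_coefficient hV (hf.mono hVΩ) hJ (d.smooth_K.mono hVΩ)
      (fun z hz => d.K_q (hVΩ hz)) hz₀⟩
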